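/- **Normal o-graphs.** A normal o-graph is an oriented virtual link diagram, up to planar isotopy and virtual Reidemeister (detour) moves, in which every component meets a real crossing. Equivalently, it is a finite set $V$ of real crossings, each with a sign $\pm1$, together with a permutation of the passages $V\times\{O,U\}$ (over and under passages) which sends each passage to the next one met along the orientation; isomorphic data are identified. An edge is an arc between two consecutive passages. Normal o-graphs represent branched standard polyhedra: the connected ones correspond to the polyhedra up to homeomorphism. They are not required to be closed, i.e. to represent closed $3$-manifolds. **Circuits.** Along each edge draw three parallel lines, numbered $1,2,3$ from left to right when the edge points upwards. At a crossing let $u_L,u_R$ be the halves of the under strand to the left and right of the over strand, and $o_L,o_R$ the halves of the over strand to the left and right of the under strand. (At a positive crossing $u_R,o_L$ are incoming and $u_L,o_R$ outgoing; at a negative crossing the reverse.) Writing $e^k$ for the $k$-th line of $e$, join $$u_L^1 - u_R^1,\quad u_L^3 - o_R^1,\quad u_R^3 - o_R^3,\quad u_L^2 - o_L^1,\quad u_R^2 - o_L^3,\quad o_R^2 - o_L^2 .$$ The resulting circuits are the boundaries of the $2$-cells of the polyhedron. **Pure sliding moves.** A pure sliding move takes two disjoint arcs of edges (possibly of the same edge),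 called left and right, and makes them cross in a pair of crossings of opposite signs (Reidemeister II). The following conditions refer to the circuits of the whole normal o-graph before the move. * ps-I: the left arc passes over the right one, arcs parallel, both meeting first the positive and then the negative crossing. Condition (PS-I): line $3$ on the left and line $2$ on the right lie on the same circuit. * ps-II: the left arc passes under the right one, arcs parallel, both meeting first the negative and then the positive crossing. Condition (PS-II): line $3$ on the left, line $1$ on the right. * ps-III: the left arc passes over the right one, arcs antiparallel; the left arc meets first the positive crossing, the right arc first the negative one. Condition (PS-III): line $1$ on the left, line $2$ on the right. * ps-IV: the left arc passes over the right one, arcs antiparallel; the left arc meets first the negative crossing, the right arc first the positive one. Condition (PS-IV): line $3$ on the left, line $3$ on the right. **MP moves.** Each replaces a local picture of three strands with crossings $x,y$ by one of the same three strands (same endpoints) with crossings $a,b,c$. Strands are given as the words of passages met along them, written "strand 0; strand 1; strand 2". * Shape A: $U_x;\ O_yO_x;\ U_y$ with signs $x,y=+,+$ becomes $U_bU_c;\ O_a;\ O_bU_aO_c$ with signs $a,b,c=+,+,-$. * Shape B: shape A with every crossing changed ($O\leftrightarrow U$ and all signs reversed). * Shape C: $U_x;\ U_yO_x;\ O_y$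 with signs $-,-$ becomes $U_cU_b;\ O_cU_a;\ O_bO_a$ with signs $-,-,-$. * Shape D: $U_x;\ O_xU_y;\ O_y$ with signs $+,+$ becomes $U_bU_c;\ U_aO_c;\ O_aO_b$ with signs $+,+,+$. In each shape two strands may be reversed, in the same way before and after the move. Reversing a strand reverses its word and changes the sign of each crossing between it and another strand. The 16 MP moves are: A1, A2, A3, A4 (respectively B1–B4), obtained from shape A (respectively B) by reversing no strand, strand $0$, strand $1$, both strands $0$ and $1$; and C1, C2, C3, C4 (respectively D1–D4), obtained from shape C (respectively D) by reversing strand $0$, no strand, both strands $0$ and $2$, strand $2$. The primary MP move is: $O_y;\ O_xU_y;\ U_x$ with signs $+,+$ becomes $O_aO_b;\ U_aO_c;\ U_bU_c$ with signs $+,+,+$. It resembles a Reidemeister III move with positive crossings, except that one of the three crossings is virtual before the move. It is D2 with its strands listed in the opposite order. **Theorem.** Each of the 16 MP moves is a sequence of primary MP moves, pure sliding moves ps-I–ps-IV (each subject to its condition), and inverses of these. That is, for each of the 16 types there is a finite word in the five generating moves and their inverses such that, whenever an arbitrary normal o-graph $\Gamma'$ is obtained from a normal o-graph $\Gamma$ by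 an MP move of that type, there is a sequence of normal o-graphs from $\Gamma$ to $\Gamma'$ whose successive terms are related by the successive letters of the word. If $\Gamma$ is connected, all terms can be taken connected. -/

import Mathlib

/-- The over strand (`upper`) and the under strand (`lower`) of a real crossing. -/
inductive Level
  | upper
  | lower

/-- The underlying object of an oriented virtual link diagram up to planar isotopy and the virtual
Reidemeister (detour) moves, with at least one real crossing on every component: its signed
oriented Gauss diagram.

`V` is the set of real crossings (true vertices) and `sign` their signs. A passage through a
crossing is a pair `(v, s)`: the over strand or the under strand of `v`. Following the orientation
of the diagram from the passage `p`, the next real crossing is met in the passage `next p`.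
Equality of diagrams is isomorphism of this data; all moves below are invariant under it.
Connectedness is a separate predicate, `IsConnected`. -/
structure NormalOGraph where
  V : Type
  finite_V : Finite V
  sign : V → ℤˣ
  next : Equiv.Perm (V × Level)

namespace NormalOGraph

/-- An edge is named by the passage it leaves; the edge `e` runs from `e` to `next e`. -/
abbrev Edge (Γ : NormalOGraph) : Type := Γ.V × Level

/-- The underlying 4-valent graph is nonempty and connected. -/
def IsConnected (Γ : NormalOGraph) : Prop :=
  Nonempty Γ.V ∧
    ∀ v w : Γ.V, Relation.EqvGen (fun a b => ∃ s t : Level, Γ.next (a, s) = (b, t)) v w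

/-! ### The circuit diagram (boundaries of the 2-cells) -/

/-- The edge arriving at `v` along the strand `s`. -/
def inEdge (Γ : NormalOGraph) (v : Γ.V) (s : Level) : Γ.Edge := Γ.next.symm (v, s)

/-- The edge leaving `v` along the strand `s`. -/
def outEdge (Γ : NormalOGraph) (v : Γ.V) (s : Level) : Γ.Edge := (v, s)

/-- The half of the under strand at `v` that lies to the left of the over strand. At a positive
crossing the under strand passes from the right to the left of the over strand. -/
def underLeft (Γ : NormalOGraph) (v : Γ.V) : Γ.Edge :=
  if Γ.sign v = 1 then Γ.outEdge v .lower else Γ.inEdge v .lower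

/-- The half of the under strand at `v` that lies to the right of the over strand. -/
def underRight (Γ : NormalOGraph) (v : Γ.V) : Γ.Edge :=
  if Γ.sign v = 1 then Γ.inEdge v .lower else Γ.outEdge v .lower

/-- The half of the over strand at `v` that lies to the left of the under strand. At a positive
crossing the over strand passes from the left to the right of the under strand. -/
def overLeft (Γ : NormalOGraph) (v : Γ.V) : Γ.Edge :=
  if Γ.sign v = 1 then Γ.inEdge v .upper else Γ.outEdge v .upper

/-- The half of the over strand at `v` that lies to the right of the under strand. -/
def overRight (Γ : NormalOGraph) (v : Γ.V) : Γ.Edge :=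
  if Γ.sign v = 1 then Γ.outEdge v .upper else Γ.inEdge v .upper

/-- The three parallel lines of the circuit diagram along each edge, numbered from left to right
when the edge points upwards: `0` is the first line (lower sheet on the left), `1` the second
(upper sheet on the left), `2` the third (the single sheet on the right). -/
abbrev Line (Γ : NormalOGraph) : Type := Γ.Edge × Fin 3

/-- How the lines of the four edge ends at a crossing are joined there. With the butterfly at a true
vertex seen as a horizontal stack of four chambers `0 < 1 < 2 < 3`, where chamber `1` lies over the
left of the under strand and chamber `2` over the left of the over strand, the six clauses are the
six 2-cell corners `01, 02, 03, 12, 13, 23`, the corner `ij` separating the chambers `i` and `j`. -/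
inductive Joined (Γ : NormalOGraph) : Γ.Line → Γ.Line → Prop
  | c01 (v : Γ.V) : Joined Γ (Γ.underLeft v, 0) (Γ.underRight v, 0)
  | c02 (v : Γ.V) : Joined Γ (Γ.underLeft v, 2) (Γ.overRight v, 0)
  | c03 (v : Γ.V) : Joined Γ (Γ.underRight v, 2) (Γ.overRight v, 2)
  | c12 (v : Γ.V) : Joined Γ (Γ.underLeft v, 1) (Γ.overLeft v, 0)
  | c13 (v : Γ.V) : Joined Γ (Γ.underRight v, 1) (Γ.overLeft v, 2)
  | c23 (v : Γ.V) : Joined Γ (Γ.overRight v, 1) (Γ.overLeft v, 1)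

/-- Two lines belong to the same circuit, i.e. run along the boundary of the same 2-cell. -/
def SameCircuit (Γ : NormalOGraph) : Γ.Line → Γ.Line → Prop :=
  Relation.EqvGen Γ.Joined

/-- The passages of `l` are met consecutively when following the orientation of `Γ`. -/
def Consecutive (Γ : NormalOGraph) (l : List (Γ.V × Level)) : Prop :=
  List.IsChain (fun p q => Γ.next p = q) l

end NormalOGraph

/-! ### Local pictures -/

/-- A local picture with `n` oriented strands and `c` real crossings (virtual crossings are not
recorded): the signs of the crossings and the passages met along each strand. -/
structure Picture (n c : ℕ) where
  sign : Fin c → ℤˣ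
  strand : Fin n → List (Fin c × Level)

/-- The same planar picture with the orientation of the strand `k` reversed: the crossings of `k`
with the other strands change their sign. -/
def Picture.reverse {n c : ℕ} (D : Picture n c) (k : Fin n) : Picture n c where
  sign i := (-1) ^ (D.strand k).countP (fun p => p.1 = i) * D.sign i
  strand := Function.update D.strand k (D.strand k).reverse

/-- A replacement of a 3-strand picture with two crossings by one with three crossings; the
`k`-th strand has the same endpoints before and after. -/
structure LocalMove where
  before : Picture 3 2
  after : Picture 3 3

/-- The move with the orientation of the strand `k` reversed on both sides. -/
def LocalMove.reverse (M : LocalMove) (k : Fin 3) : LocalMove :=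
  ⟨M.before.reverse k, M.after.reverse k⟩

/-- `Γ` is obtained by placing the picture `D` (all of whose strands pass through a crossing) in an
exterior with crossings `W` and signs `σ`. The permutation `ctx` describes the exterior, the
strands of `D` being considered as bivalent points of it: it sends an exterior passage, or the end
of a strand of `D`, to the exterior passage, or the beginning of a strand of `D`, which follows. -/
def NormalOGraph.Realizes (Γ : NormalOGraph) {n c : ℕ} (D : Picture n c) {W : Type}
    (σ : W → ℤˣ) (ctx : Equiv.Perm ((W × Level) ⊕ Fin n)) : Prop :=
  ∃ f : W ⊕ Fin c ≃ Γ.V,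
    (∀ w, Γ.sign (f (.inl w)) = σ w) ∧
    (∀ i, Γ.sign (f (.inr i)) = D.sign i) ∧
    let passages : (W × Level) ⊕ Fin n → List (Γ.V × Level) :=
      Sum.elim (fun p => [(f (.inl p.1), p.2)])
        (fun k => (D.strand k).map fun p => (f (.inr p.1), p.2))
    ∀ x, Γ.Consecutive (passages x ++ passages (ctx x))

/-- `Γ'` is obtained from `Γ` by replacing an occurrence of `M.before` by `M.after`. -/
def LocalMove.Rel (M : LocalMove) (Γ Γ' : NormalOGraph) : Prop :=
  ∃ (W : Type) (σ : W → ℤˣ) (ctx : Equiv.Perm ((W × Level) ⊕ Fin 3)),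
    Γ.Realizes M.before σ ctx ∧ Γ'.Realizes M.after σ ctx

/-! ### The 16 MP moves and the primary MP move -/

open Level in
/-- The picture of type A: the strand `1` crosses over the strands `0` and `2`. -/
def shapeA : LocalMove where
  before := ⟨![1, 1], ![[(0, lower)], [(1, upper), (0, upper)], [(1, lower)]]⟩
  after := ⟨![1, 1, -1],
    ![[(1, lower), (2, lower)], [(0, upper)], [(1, upper), (0, lower), (2, upper)]]⟩

open Level in
/-- The picture of type B: the picture of type A with every crossing changed. -/
def shapeB : LocalMove where
  before := ⟨![-1, -1], ![[(0, upper)], [(1, lower), (0, lower)], [(1, upper)]]⟩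
  after := ⟨![-1, -1, 1],
    ![[(1, upper), (2, upper)], [(0, lower)], [(1, lower), (0, upper), (2, lower)]]⟩

open Level in
/-- The picture of type C: the strand `0` is below the strand `1`, which is below the strand `2`.
On the left the strands `0` and `2` cross virtually; along the strand `1`, the crossing with the
strand `2` comes first on the left and last on the right. -/
def shapeC : LocalMove where
  before := ⟨![-1, -1], ![[(0, lower)], [(1, lower), (0, upper)], [(1, upper)]]⟩
  after := ⟨![-1, -1, -1],
    ![[(2, lower), (1, lower)], [(2, upper), (0, lower)], [(1, upper), (0, upper)]]⟩

open Level in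
/-- The picture of type D: as in type C, with the strand `1` running in the opposite order and all
crossings positive. -/
def shapeD : LocalMove where
  before := ⟨![1, 1], ![[(0, lower)], [(0, upper), (1, lower)], [(1, upper)]]⟩
  after := ⟨![1, 1, 1],
    ![[(1, lower), (2, lower)], [(0, lower), (2, upper)], [(0, upper), (1, upper)]]⟩

/-- The names of the 16 MP moves. -/
inductive MPType
  | A1 | A2 | A3 | A4
  | B1 | B2 | B3 | B4
  | C1 | C2 | C3 | C4
  | D1 | D2 | D3 | D4

/-- The 16 MP moves. In each of the four pictures two strands have arbitrary orientation (the same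
one before and after the move): the strands `0` and `1` in the types A and B, the strands `0` and
`2` in the types C and D. -/
def MPType.move : MPType → LocalMove
  | A1 => shapeA
  | A2 => shapeA.reverse 0
  | A3 => shapeA.reverse 1
  | A4 => (shapeA.reverse 0).reverse 1
  | B1 => shapeB
  | B2 => shapeB.reverse 0
  | B3 => shapeB.reverse 1
  | B4 => (shapeB.reverse 0).reverse 1
  | C1 => shapeC.reverse 0
  | C2 => shapeC
  | C3 => (shapeC.reverse 0).reverse 2
  | C4 => shapeC.reverse 2
  | D1 => shapeD.reverse 0
  | D2 => shapeD
  | D3 => (shapeD.reverse 0).reverse 2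
  | D4 => shapeD.reverse 2

open Level in
/-- The primary MP move. Like a Reidemeister III move with three positive crossings, the strand `0`
passing over the strand `1` and both over the strand `2`, except that before the move the
crossing of the strands `0` and `2` is virtual. With `S i j` the crossing of the strand `i` over
the strand `j`, this is the pentagon relation `S 1 2 * S 0 1 = S 0 1 * S 0 2 * S 1 2`. -/
def primaryMP : LocalMove where
  before := ⟨![1, 1], ![[(1, upper)], [(0, upper), (1, lower)], [(0, lower)]]⟩
  after := ⟨![1, 1, 1],
    ![[(0, upper), (1, upper)], [(0, lower), (2, upper)], [(1, lower), (2, lower)]]⟩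

/-! ### The pure sliding moves -/

/-- The names of the four pure sliding moves. -/
inductive PSType
  | I | II | III | IV

open Level in
/-- The result of the move: two strands in Reidemeister II position, the strand `0` being the left
one and the strand `1` the right one. They are parallel in I and II, antiparallel in III and IV. -/
def PSType.picture : PSType → Picture 2 2
  | I => ⟨![1, -1], ![[(0, upper), (1, upper)], [(0, lower), (1, lower)]]⟩
  | II => ⟨![-1, 1], ![[(0, lower), (1, lower)], [(0, upper), (1, upper)]]⟩
  | III => ⟨![1, -1], ![[(0, upper), (1, upper)], [(1, lower), (0, lower)]]⟩
  | IV => ⟨![-1, 1], ![[(0, upper), (1, upper)], [(1, lower), (0, lower)]]⟩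

/-- The line of the left edge and the line of the right edge that have to be connected. The lines
are numbered from `0`, so that `2` is the third line. -/
def PSType.lines : PSType → Fin 3 × Fin 3
  | I => (2, 1)
  | II => (2, 0)
  | III => (0, 1)
  | IV => (2, 2)

open scoped Classical in
/-- `Γ'` is obtained from `Γ` by the pure sliding move `t` on an arc of the edge `a` (on the left)
and an arc of the edge `b` (on the right). If `a = b`, these are two disjoint arcs of one edge, in
either order. The condition on the circuit diagram is the one of `Γ`, before the move. -/
def PSType.Rel (t : PSType) (Γ Γ' : NormalOGraph) : Prop :=
  ∃ a b : Γ.Edge, Γ.SameCircuit (a, t.lines.1) (b, t.lines.2) ∧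
    ∃ f : Γ.V ⊕ Fin 2 ≃ Γ'.V,
      (∀ v, Γ'.sign (f (.inl v)) = Γ.sign v) ∧
      (∀ i, Γ'.sign (f (.inr i)) = t.picture.sign i) ∧
      let old : Γ.V × Level → Γ'.V × Level := fun p => (f (.inl p.1), p.2)
      let new : Fin 2 → List (Γ'.V × Level) := fun k =>
        (t.picture.strand k).map fun p => (f (.inr p.1), p.2)
      let onLeft : Γ.Edge → List (Γ'.V × Level) := fun e => if e = a then new 0 else []
      let onRight : Γ.Edge → List (Γ'.V × Level) := fun e => if e = b then new 1 else []
      (∀ e, Γ'.Consecutive ([old e] ++ onLeft e ++ onRight e ++ [old (Γ.next e)])) ∨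
      (∀ e, Γ'.Consecutive ([old e] ++ onRight e ++ onLeft e ++ [old (Γ.next e)]))

/-! ### Sequences of moves -/

/-- The generating moves: the primary MP move and the four pure sliding moves. -/
inductive Generator
  | primary
  | slide (t : PSType)

def Generator.Rel : Generator → NormalOGraph → NormalOGraph → Prop
  | primary => primaryMP.Rel
  | slide t => t.Rel

/-- A generating move or the inverse of one. -/
inductive Step
  | forward (g : Generator)
  | inverse (g : Generator)

def Step.Rel : Step → NormalOGraph → NormalOGraph → Prop
  | forward g, Γ, Γ' => g.Rel Γ Γ'
  | inverse g, Γ, Γ' => g.Rel Γ' Γ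

/-! The argument is a calculation with local pictures, made uniform in the exterior.
`Picture.Derives` asks for one word that leads from one picture to another in every context, so the
word is chosen before the graph. Two facts allow working inside a picture. First, when a picture is
a template with its gaps filled, the crossings of the template can be absorbed into the exterior
(`NormalOGraph.Realizes.of_isFill`), so a derived move may be applied inside a larger picture
(`Picture.Derives.of_move`). Second, the condition of a pure sliding move concerns circuits of the
whole graph, but a piece of a circuit inside the picture already connects the two lines
(`NormalOGraph.sameCircuit_of_isChain`). A finite check on the picture therefore licenses the move
in every context (`PSType.rel_of_isFill`).

The MP moves then follow from the primary one by two patterns. In the first, a slide creates two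
crossings and the inverse of a known move removes one. In the second, a known move is preceded by a
slide and followed by the inverse of a slide. The dependencies form a tree. The primary move gives
D2, A1, A2, B3, B4 and C3; A1 gives B2 and C4; A2 gives B1 and D1; B2 gives D3 and B4 gives D4; B3
gives C1, which gives A4; B1 gives C2, which gives A3. Each piece of data is verified by `decide`.

Connectedness is a separate matter: every generating move preserves it in both directions
(`Step.isConnected_iff`). For undoing a slide this uses the circuit condition, because a circuit
stays in one component. -/

/-! ### Splicing words into a permutation -/

/-- The words `L k` are nonempty and together contain every letter exactly once. -/
structure IsPartition {Y : Type} {n : ℕ} (L : Fin n → List Y) : Prop where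
  ne_nil : ∀ k, L k ≠ []
  nodup : (List.ofFn L).flatten.Nodup
  mem : ∀ y, ∃ k, y ∈ L k

instance {Y : Type} [Fintype Y] [DecidableEq Y] {n : ℕ} (L : Fin n → List Y) :
    Decidable (IsPartition L) :=
  decidable_of_iff ((∀ k, L k ≠ []) ∧ (List.ofFn L).flatten.Nodup ∧ ∀ y, ∃ k, y ∈ L k)
    ⟨fun h => ⟨h.1, h.2.1, h.2.2⟩, fun h => ⟨h.1, h.2, h.3⟩⟩

/-- The word standing for a point of `X` or for one of the words `L k`. -/
def block {X Y : Type} {n : ℕ} (L : Fin n → List Y) : X ⊕ Fin n → List (X ⊕ Y) :=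
  Sum.elim (fun x => [.inl x]) (fun k => (L k).map .inr)

theorem IsPartition.block_ne_nil {X Y : Type} {n : ℕ} {L : Fin n → List Y} (hL : IsPartition L)
    (x : X ⊕ Fin n) : block L x ≠ [] := by
  rcases x with x | k
  · simp [block]
  · simpa [block] using hL.ne_nil k

theorem IsPartition.mem_block {X Y : Type} {n : ℕ} {L : Fin n → List Y} (hL : IsPartition L)
    (t : X ⊕ Y) : ∃ x, t ∈ block L x := by
  rcases t with x | y
  · exact ⟨.inl x, by simp [block]⟩
  · obtain ⟨k, hk⟩ := hL.mem y
    exact ⟨.inr k, by simpa [block] using hk⟩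

/-- Absence of repetitions in the concatenation makes the words disjoint and each word free of
repetitions, so a letter determines its word and its position there. -/
theorem IsPartition.bijective {Y : Type} {n : ℕ} {L : Fin n → List Y} (hL : IsPartition L) :
    Function.Bijective (fun i : Σ k, Fin (L k).length => (L i.1)[i.2]) := by
  obtain ⟨h₁, h₂⟩ := List.nodup_flatten.1 hL.nodup
  constructor
  · rintro ⟨k, i⟩ ⟨l, j⟩ h
    have h' : (L k)[i.1] = (L l)[j.1] := h
    have hkl : k = l := by
      by_contra hne
      have key : ∀ k l : Fin n, k < l → List.Disjoint (L k) (L l) := by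
        intro k l hkl
        have := List.pairwise_iff_getElem.1 h₂ k l (by simp) (by simp) hkl
        simpa using this
      rcases lt_or_gt_of_ne hne with hlt | hlt
      · exact key _ _ hlt (List.getElem_mem i.2) (h' ▸ List.getElem_mem j.2)
      · exact key _ _ hlt (List.getElem_mem j.2) (h' ▸ List.getElem_mem i.2)
    subst hkl
    have hk : (L k).Nodup := h₁ _ (by simp)
    have := (hk.getElem_inj_iff (hi := i.2) (hj := j.2)).1 h
    congr 1
    exact Fin.ext this
  · intro y
    obtain ⟨k, hk⟩ := hL.mem y
    obtain ⟨i, hi, rfl⟩ := List.getElem_of_mem hk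
    exact ⟨⟨k, i, hi⟩, rfl⟩

theorem finRotate_mk_of_lt {N i : ℕ} (h : i + 1 < N) :
    finRotate N ⟨i, by omega⟩ = ⟨i + 1, h⟩ := by
  obtain ⟨m, rfl⟩ : ∃ m, N = m + 1 := ⟨N - 1, by omega⟩
  exact finRotate_of_lt (by omega)

theorem finRotate_mk_of_eq {N i : ℕ} (h : i + 1 = N) :
    finRotate N ⟨i, by omega⟩ = ⟨0, by omega⟩ := by
  subst h
  exact finRotate_last'

/-- A permutation of `X` and the names of the words refines to a permutation of `X` and the letters
of the words that runs through each word. -/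
theorem IsPartition.exists_splice {X Y : Type} {n : ℕ} {L : Fin n → List Y} (hL : IsPartition L)
    (ctx : Equiv.Perm (X ⊕ Fin n)) :
    ∃ q : Equiv.Perm (X ⊕ Y), ∀ x,
      (block L x ++ block L (ctx x)).IsChain (fun s t => q s = t) := by
  let E := Equiv.ofBijective _ hL.bijective
  have hlen : ∀ k, 0 < (L k).length := fun k => List.length_pos_iff.2 (hL.ne_nil k)
  let R : Equiv.Perm Y := E.symm.trans ((Equiv.sigmaCongrRight fun k => finRotate _).trans E)
  have hE : ∀ k i (hi : i < (L k).length), E ⟨k, i, hi⟩ = (L k)[i] := fun _ _ _ => rfl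
  have hR : ∀ k i (hi : i < (L k).length), R (L k)[i] = E ⟨k, finRotate _ ⟨i, hi⟩⟩ := by
    intro k i hi
    rw [← hE k i hi]
    simp [R]
  have hR₁ : ∀ k i (hi : i + 1 < (L k).length), R (L k)[i] = (L k)[i + 1] := by
    intro k i hi
    rw [hR k i (by omega), ← hE k (i + 1) hi]
    rw [finRotate_mk_of_lt hi]
  have hR₂ : ∀ k i (hi : i < (L k).length), i + 1 = (L k).length →
      R (L k)[i] = (L k)[0]'(hlen k) := by
    intro k i hi hi'
    rw [hR k i hi, ← hE k 0 (hlen k)]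
    rw [finRotate_mk_of_eq hi']
  let ι : X ⊕ Fin n ↪ X ⊕ Y := ⟨Sum.map id fun k => (L k)[0]'(hlen k), by
    refine Sum.map_injective.2 ⟨Function.injective_id, fun k l h => ?_⟩
    have := hL.bijective.1 (a₁ := ⟨k, 0, hlen k⟩) (a₂ := ⟨l, 0, hlen l⟩) h
    exact (Sigma.mk.inj_iff.1 this).1⟩
  have hι : ∀ k i (hi : i + 1 < (L k).length), Sum.inr (L k)[i + 1] ∉ Set.range ι := by
    rintro k i hi ⟨x | l, hx⟩
    · simp [ι] at hx
    · have hx' : (L l)[0]'(hlen l) = (L k)[i + 1] := by simpa [ι] using hx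
      have := hL.bijective.1 (a₁ := ⟨l, 0, hlen l⟩) (a₂ := ⟨k, i + 1, hi⟩) hx'
      obtain ⟨rfl, h⟩ := Sigma.mk.inj_iff.1 this
      simp at h
  -- First `R` advances cyclically in each word, then `ctx` acts on the points of `X` and the first
  -- letters. A letter that is not last goes to one that is not first, which `ctx` leaves alone. A
  -- last letter returns to the head of its word, and `ctx` carries it to the head of the next
  -- block. Being a composite of permutations, `q` is one.
  let q : Equiv.Perm (X ⊕ Y) := (Equiv.sumCongr (Equiv.refl X) R).trans (ctx.viaEmbedding ι)
  have hq₁ : ∀ x, q (.inl x) = ι (ctx (.inl x)) := fun x =>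
    Equiv.Perm.viaEmbedding_apply ctx ι (.inl x)
  have hq₂ : ∀ k i (hi : i + 1 < (L k).length), q (.inr (L k)[i]) = .inr (L k)[i + 1] := by
    intro k i hi
    rw [← hR₁ k i hi]
    refine Equiv.Perm.viaEmbedding_apply_of_notMem ctx ι _ ?_
    simpa [hR₁ k i hi] using hι k i hi
  have hq₃ : ∀ k i (hi : i < (L k).length), i + 1 = (L k).length →
      q (.inr (L k)[i]) = ι (ctx (.inr k)) := by
    intro k i hi hi'
    rw [← Equiv.Perm.viaEmbedding_apply ctx ι (.inr k)]
    exact congrArg (fun y => ctx.viaEmbedding ι (.inr y)) (hR₂ k i hi hi')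
  have hhead : ∀ x, (block L x).head? = some (ι x) := by
    rintro (x | k)
    · simp [block, ι]
    · simp [block, ι, List.head?_eq_getElem?, hlen k]
  have hblock : ∀ x, (block L x).IsChain (fun s t => q s = t) := by
    rintro (x | k)
    · simp [block]
    · rw [List.isChain_iff_getElem]
      intro i hi
      simpa [block] using hq₂ k i (by simpa [block] using hi)
  refine ⟨q, fun x => (hblock x).append (hblock _) fun s hs t ht => ?_⟩
  rw [hhead] at ht
  obtain rfl := Option.mem_some_iff.1 ht
  rcases x with x | k
  · obtain rfl : s = .inl x := by simpa [block, eq_comm] using hs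
    exact hq₁ x
  · have hk := hlen k
    obtain rfl : s = .inr ((L k)[(L k).length - 1]) := by
      simpa [block, List.getLast?_eq_getElem?, hk, eq_comm] using hs
    exact hq₃ k _ _ (by omega)

/-- The nonempty `r` provides a successor even for the last letter of `l`. This lets a statement
about `t` and `q t` be read off from the block of a context and the block that follows it. -/
theorem exists_infix_of_mem {α : Type} {q : α → α} {l r : List α}
    (h : (l ++ r).IsChain (fun s t => q s = t)) (hr : r ≠ []) {t : α} (ht : t ∈ l) :
    [t, q t] <:+: l ++ r := by
  obtain ⟨l₁, l₂, rfl⟩ := List.append_of_mem ht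
  obtain ⟨u, m, hm⟩ : ∃ u m, l₂ ++ r = u :: m := List.exists_cons_of_ne_nil (by simp [hr])
  have heq : l₁ ++ t :: l₂ ++ r = l₁ ++ [t, u] ++ m := by simp [hm]
  rw [heq] at h ⊢
  have : q t = u := by simpa using h.infix ⟨l₁, m, rfl⟩
  exact ⟨l₁, m, by rw [this]⟩

/-- If the word of every letter is followed by the word of its image, then chains of letters give
chains of words. -/
theorem isChain_flatMap {α β : Type} {q : α → α} {R : β → β → Prop} {f : α → List β}
    (hf : ∀ x, f x ≠ []) (h : ∀ x, (f x ++ f (q x)).IsChain R) :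
    ∀ {l : List α}, l.IsChain (fun s t => q s = t) → (l.flatMap f).IsChain R
  | [], _ => by simp
  | [x], _ => by simpa using (h x).left_of_append
  | x :: y :: l, hl => by
    obtain ⟨rfl, hl'⟩ := List.isChain_cons_cons.1 hl
    have := isChain_flatMap hf h hl'
    simp only [List.flatMap_cons] at this ⊢
    -- The two chains overlap in the word of the middle letter; they can be glued because this word
    -- is nonempty.
    simpa using (h x).append_overlap this (hf _)

instance : DecidableEq Level := fun
  | .upper, .upper => isTrue rfl
  | .lower, .lower => isTrue rfl
  | .upper, .lower => isFalse (fun h => nomatch h)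
  | .lower, .upper => isFalse (fun h => nomatch h)

instance : Fintype Level := ⟨{.upper, .lower}, by rintro (_ | _) <;> simp⟩

/-! ### Realizations of pictures -/

namespace NormalOGraph

/-- The passages of `Γ` that stand for an exterior passage or a strand of the picture `D`. -/
def passages {Γ : NormalOGraph} {n c : ℕ} (D : Picture n c) {W : Type} (f : W ⊕ Fin c ≃ Γ.V) :
    (W × Level) ⊕ Fin n → List (Γ.V × Level) :=
  Sum.elim (fun p => [(f (.inl p.1), p.2)]) (fun k => (D.strand k).map fun p => (f (.inr p.1), p.2))

theorem realizes_iff {Γ : NormalOGraph} {n c : ℕ} {D : Picture n c} {W : Type} {σ : W → ℤˣ}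
    {ctx : Equiv.Perm ((W × Level) ⊕ Fin n)} :
    Γ.Realizes D σ ctx ↔ ∃ f : W ⊕ Fin c ≃ Γ.V,
      (∀ w, Γ.sign (f (.inl w)) = σ w) ∧ (∀ i, Γ.sign (f (.inr i)) = D.sign i) ∧
      ∀ x, Γ.Consecutive (passages D f x ++ passages D f (ctx x)) :=
  Iff.rfl

theorem passages_ne_nil {Γ : NormalOGraph} {n c : ℕ} {D : Picture n c} (hD : ∀ k, D.strand k ≠ [])
    {W : Type} (f : W ⊕ Fin c ≃ Γ.V) (x) : passages D f x ≠ [] := by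
  rcases x with x | k <;> simp [passages, hD]

theorem exists_mem_passages {Γ : NormalOGraph} {n c : ℕ} {D : Picture n c}
    (hD : ∀ p, ∃ k, p ∈ D.strand k) {W : Type} (f : W ⊕ Fin c ≃ Γ.V) (p : Γ.V × Level) :
    ∃ x, p ∈ passages D f x := by
  obtain ⟨v, s⟩ := p
  obtain ⟨w | i, rfl⟩ := f.surjective v
  · exact ⟨.inl (w, s), by simp [passages]⟩
  · obtain ⟨k, hk⟩ := hD (i, s)
    exact ⟨.inr k, by simpa [passages] using hk⟩

theorem Consecutive.infix {Γ : NormalOGraph} {l m : List (Γ.V × Level)} (h : Γ.Consecutive m)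
    (hl : l <:+: m) : Γ.Consecutive l :=
  List.IsChain.infix h hl

theorem Consecutive.next_eq {Γ : NormalOGraph} {l : List (Γ.V × Level)} {p q : Γ.V × Level}
    (h : Γ.Consecutive l) (hl : [p, q] <:+: l) : Γ.next p = q := by
  simpa [Consecutive] using h.infix hl

theorem Realizes.finite {Γ : NormalOGraph} {n c : ℕ} {D : Picture n c} {W : Type} {σ : W → ℤˣ}
    {ctx : Equiv.Perm ((W × Level) ⊕ Fin n)} (h : Γ.Realizes D σ ctx) : Finite W := by
  obtain ⟨f, -⟩ := h
  have := Γ.finite_V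
  exact Finite.of_injective (fun w => f (.inl w)) (f.injective.comp Sum.inl_injective)

end NormalOGraph

open NormalOGraph

/-- A picture whose strands partition its passages occurs in every finite context. -/
theorem Picture.exists_realizes {n c : ℕ} {D : Picture n c} (hD : IsPartition D.strand) {W : Type}
    [Finite W] (σ : W → ℤˣ) (ctx : Equiv.Perm ((W × Level) ⊕ Fin n)) :
    ∃ Γ : NormalOGraph, Γ.Realizes D σ ctx := by
  obtain ⟨q, hq⟩ := hD.exists_splice ctx
  let E : (W × Level) ⊕ (Fin c × Level) ≃ (W ⊕ Fin c) × Level := (Equiv.sumProdDistrib _ _ _).symm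
  refine ⟨⟨W ⊕ Fin c, inferInstance, Sum.elim σ D.sign, (E.symm.trans q).trans E⟩,
    Equiv.refl _, fun _ => rfl, fun _ => rfl, fun x => ?_⟩
  have hp : ∀ x, passages (Γ := ⟨W ⊕ Fin c, inferInstance, Sum.elim σ D.sign,
      (E.symm.trans q).trans E⟩) D (Equiv.refl _) x = (block D.strand x).map E := by
    rintro (x | k)
    · rfl
    · simp only [passages, block, Sum.elim_inr, List.map_map]
      rfl
  change Consecutive _ (passages D _ x ++ passages D _ (ctx x))
  rw [hp, hp, ← List.map_append]
  refine (List.isChain_map _).2 ((hq x).imp ?_)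
  rintro s t rfl
  simp

/-! ### Templates -/

/-- A picture with `s` named gaps in its strands. -/
structure Template (n m s : ℕ) where
  sign : Fin m → ℤˣ
  strand : Fin n → List ((Fin m × Level) ⊕ Fin s)

/-- The passages of a picture with `c` crossings filled into the gaps of a template. -/
def Template.letter {m s c d : ℕ} (B : Picture s c) (e : Fin m ⊕ Fin c → Fin d) :
    (Fin m × Level) ⊕ Fin s → List (Fin d × Level) :=
  Sum.elim (fun p => [(e (.inl p.1), p.2)]) (fun k => (B.strand k).map fun p => (e (.inr p.1), p.2))

/-- The picture `D` is the template `T` filled with the strands of `B`, the crossings being named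
according to `e`. -/
structure Template.IsFill {n m s c d : ℕ} (T : Template n m s) (B : Picture s c) (D : Picture n d)
    (e : Fin m ⊕ Fin c → Fin d) : Prop where
  bijective : Function.Bijective e
  sign_inl : ∀ i, D.sign (e (.inl i)) = T.sign i
  sign_inr : ∀ i, D.sign (e (.inr i)) = B.sign i
  strand : ∀ k, D.strand k = (T.strand k).flatMap (letter B e)

/-- The context that consists of the splice of a template and an exterior. -/
def spliceContext {W : Type} {m s : ℕ} (q : Equiv.Perm ((W × Level) ⊕ ((Fin m × Level) ⊕ Fin s))) :
    Equiv.Perm (((W ⊕ Fin m) × Level) ⊕ Fin s) :=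
  let E := (Equiv.sumAssoc _ _ _).symm.trans
    (Equiv.sumCongr (Equiv.sumProdDistrib W (Fin m) Level).symm (Equiv.refl (Fin s)))
  (E.symm.trans q).trans E

/-- An occurrence of a filled template is an occurrence of the filling. -/
theorem NormalOGraph.Realizes.of_isFill {Γ : NormalOGraph} {n m s c d : ℕ} {T : Template n m s}
    {B : Picture s c} {D : Picture n d} {e : Fin m ⊕ Fin c → Fin d} (hT : IsPartition T.strand)
    (hD : T.IsFill B D e) {W : Type} {σ : W → ℤˣ} {ctx : Equiv.Perm ((W × Level) ⊕ Fin n)}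
    {q : Equiv.Perm ((W × Level) ⊕ ((Fin m × Level) ⊕ Fin s))}
    (hq : ∀ x, (block T.strand x ++ block T.strand (ctx x)).IsChain (fun s t => q s = t))
    (h : Γ.Realizes D σ ctx) : Γ.Realizes B (Sum.elim σ T.sign) (spliceContext q) := by
  obtain ⟨f, hf₁, hf₂, hf₃⟩ := realizes_iff.1 h
  let g : (W ⊕ Fin m) ⊕ Fin c ≃ Γ.V := ((Equiv.sumAssoc _ _ _).trans
    (Equiv.sumCongr (Equiv.refl W) (Equiv.ofBijective e hD.bijective))).trans f
  have hg₁ : ∀ w, g (.inl (.inl w)) = f (.inl w) := fun _ => rfl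
  have hg₂ : ∀ i, g (.inl (.inr i)) = f (.inr (e (.inl i))) := fun _ => rfl
  have hg₃ : ∀ i, g (.inr i) = f (.inr (e (.inr i))) := fun _ => rfl
  let E : (W × Level) ⊕ ((Fin m × Level) ⊕ Fin s) ≃ ((W ⊕ Fin m) × Level) ⊕ Fin s :=
    (Equiv.sumAssoc _ _ _).symm.trans
      (Equiv.sumCongr (Equiv.sumProdDistrib W (Fin m) Level).symm (Equiv.refl (Fin s)))
  refine realizes_iff.2 ⟨g, ?_, fun i => ?_, fun y => ?_⟩
  · rintro (w | i)
    · exact hf₁ w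
    · rw [hg₂, hf₂, hD.sign_inl]; rfl
  · rw [hg₃, hf₂, hD.sign_inr]
  · obtain ⟨t, rfl⟩ := E.surjective y
    have hE : spliceContext q (E t) = E (q t) := by
      change E (q (E.symm (E t))) = _
      rw [Equiv.symm_apply_apply]
    have hp : ∀ x, passages D f x = (block T.strand x).flatMap fun t => passages B g (E t) := by
      rintro (x | k)
      · simp [passages, block, E, hg₁]
      · simp only [passages, block, Sum.elim_inr, hD.strand, List.map_flatMap, List.flatMap_map]
        congr 1
        funext t
        rcases t with p | j
        · simp [Template.letter, E, hg₂]
        · simp [Template.letter, E, hg₃, Function.comp_def]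
    -- Every letter `t` occurs in some block of the coarse context, where `q t` is next to it.
    -- Expanding both letters gives an infix of a word already known to be consecutive in `Γ`.
    obtain ⟨x, hx⟩ := hT.mem_block (X := W × Level) t
    obtain ⟨l₁, l₂, hl⟩ := exists_infix_of_mem (hq x) (hT.block_ne_nil _) hx
    refine (hf₃ x).infix ?_
    rw [hE, hp, hp, ← List.flatMap_append, ← hl]
    simp only [List.flatMap_append, List.flatMap_cons, List.flatMap_nil, List.append_nil]
    exact ⟨_, _, rfl⟩

/-- Replacing one filling of a template by another is a local move. -/
theorem LocalMove.rel_of_isFill {M : LocalMove} {n m d d' : ℕ} {T : Template n m 3}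
    {D : Picture n d} {D' : Picture n d'} {e : Fin m ⊕ Fin 2 → Fin d} {e' : Fin m ⊕ Fin 3 → Fin d'}
    (hT : IsPartition T.strand) (hD : T.IsFill M.before D e) (hD' : T.IsFill M.after D' e')
    {W : Type} {σ : W → ℤˣ} {ctx : Equiv.Perm ((W × Level) ⊕ Fin n)} {Γ Γ' : NormalOGraph}
    (h : Γ.Realizes D σ ctx) (h' : Γ'.Realizes D' σ ctx) : M.Rel Γ Γ' := by
  -- The splice depends only on the template and `ctx`, not on the filling, so both graphs acquire
  -- the same enlarged exterior.
  obtain ⟨q, hq⟩ := hT.exists_splice ctx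
  exact ⟨_, _, _, h.of_isFill hT hD hq, h'.of_isFill hT hD' hq⟩

/-! ### Erasing marks from a permutation -/

/-- `z` is the first point that is not a mark on the orbit of `t` under `q`, starting at `t`. -/
inductive FirstPoint {Z M : Type} (q : Z ⊕ M → Z ⊕ M) : Z ⊕ M → Z → Prop
  | here (z : Z) : FirstPoint q (.inl z) z
  | skip (i : M) (z : Z) (h : FirstPoint q (q (.inr i)) z) : FirstPoint q (.inr i) z

namespace FirstPoint

variable {Z M : Type} {q : Z ⊕ M → Z ⊕ M}

theorem inl_eq {y z : Z} (h : FirstPoint q (.inl y) z) : y = z := by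
  cases h; rfl

theorem of_inr {i : M} {z : Z} (h : FirstPoint q (.inr i) z) : FirstPoint q (q (.inr i)) z := by
  cases h; assumption

/-- An orbit that reaches a point is not contained in a set of marks. -/
theorem not_invariant {P : M → Prop} (hP : ∀ i, P i → ∃ j, q (.inr i) = .inr j ∧ P j)
    {t : Z ⊕ M} {z : Z} (h : FirstPoint q t z) : ∀ i, t = .inr i → ¬ P i := by
  induction h with
  | here z => intro i hi; cases hi
  | skip j z h ih =>
    rintro i hi hPi
    obtain rfl := Sum.inr_injective hi
    obtain ⟨k, hk, hPk⟩ := hP _ hPi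
    exact ih k hk hPk

/-- Every entry before the first surviving point of the word is a mark, and the chain follows `q`,
so these marks are skipped one at a time. -/
theorem of_isChain {t : Z ⊕ M} {z : Z} : ∀ {l : List (Z ⊕ M)} {r : List Z},
    (t :: l).IsChain (fun s t => q s = t) → (t :: l).filterMap Sum.getLeft? = z :: r →
      FirstPoint q t z := by
  rintro l r h hz
  induction l generalizing t with
  | nil =>
    rcases t with y | i
    · obtain ⟨rfl, -⟩ : y = z ∧ _ := by simpa using hz
      exact .here y
    · cases hz
  | cons u l ih =>
    rcases t with y | i
    · obtain ⟨rfl, -⟩ : y = z ∧ _ := by simpa using hz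
      exact .here y
    · obtain ⟨rfl, h'⟩ := List.isChain_cons_cons.1 h
      exact .skip i z (ih h' ((List.filterMap_cons_none rfl).symm.trans hz))

end FirstPoint

open scoped Classical in
/-- If erasing two marks from the permutation `q` leaves `nx`, then the marks `0` and `1` lie on
arcs from `a` to `nx a` and from `b` to `nx b`. -/
theorem exists_arcs {Z : Type} (q : Equiv.Perm (Z ⊕ Fin 2)) (nx : Z → Z)
    (h₁ : ∀ z, FirstPoint q (q (.inl z)) (nx z)) (h₂ : ∀ i, ∃ z, FirstPoint q (.inr i) z) :
    ∃ a b : Z, (∀ z, q (.inl z) = .inr 0 → z = a) ∧ (∀ z, q (.inr 0) = .inl z → nx a = z) ∧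
      (∀ z, q (.inl z) = .inr 1 → z = b) ∧ (∀ z, q (.inr 1) = .inl z → nx b = z) ∧
      ((∀ z, (([Sum.inl z] : List (Z ⊕ Fin 2)) ++ (if z = a then [Sum.inr 0] else []) ++
          (if z = b then [Sum.inr 1] else []) ++ [Sum.inl (nx z)]).IsChain (fun s t => q s = t)) ∨
        (∀ z, (([Sum.inl z] : List (Z ⊕ Fin 2)) ++ (if z = b then [Sum.inr 1] else []) ++
          (if z = a then [Sum.inr 0] else []) ++ [Sum.inl (nx z)]).IsChain (fun s t => q s = t))) := by
  -- Here and in `hswap`, a cycle consisting of marks only is excluded, since by `h₂` every mark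
  -- eventually leads to a point.
  have hfix : ∀ i, q (.inr i) ≠ .inr i := by
    intro i hi
    obtain ⟨z, hz⟩ := h₂ i
    exact hz.not_invariant (P := fun j => j = i) (by rintro _ rfl; exact ⟨_, hi, rfl⟩) i rfl rfl
  have hswap : ¬ (q (.inr 0) = .inr 1 ∧ q (.inr 1) = .inr 0) := by
    rintro ⟨h01, h10⟩
    obtain ⟨z, hz⟩ := h₂ 0
    refine hz.not_invariant (P := fun _ => True) (fun i _ => ?_) 0 rfl trivial
    fin_cases i
    · exact ⟨_, h01, trivial⟩
    · exact ⟨_, h10, trivial⟩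
  have hinl : ∀ z y, q (.inl z) = .inl y → nx z = y := fun z y h =>
    (h ▸ h₁ z).inl_eq.symm
  have hinr : ∀ z i y, q (.inl z) = .inr i → q (.inr i) = .inl y → nx z = y := fun z i y h h' =>
    (h' ▸ (h ▸ h₁ z).of_inr).inl_eq.symm
  have hinrr : ∀ z i j y, q (.inl z) = .inr i → q (.inr i) = .inr j → q (.inr j) = .inl y →
      nx z = y := fun z i j y h h' h'' =>
    (h'' ▸ (h' ▸ (h ▸ h₁ z).of_inr).of_inr).inl_eq.symm
  have hinj : ∀ {s t u}, q s = u → q t = u → s = t := fun h h' => q.injective (h.trans h'.symm)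
  obtain ⟨s₀, hs₀⟩ := q.surjective (.inr 0)
  obtain ⟨s₁, hs₁⟩ := q.surjective (.inr 1)
  have hother : ∀ z, .inl z ≠ s₀ → .inl z ≠ s₁ → q (.inl z) = .inl (nx z) := by
    intro z hz₀ hz₁
    rcases hy : q (.inl z) with y | i
    · rw [hinl z y hy]
    · exfalso
      fin_cases i
      · exact hz₀ (hinj hy hs₀)
      · exact hz₁ (hinj hy hs₁)
  have hpoint : ∀ i, .inr i ≠ s₀ → .inr i ≠ s₁ → ∃ y, q (.inr i) = .inl y := by
    intro i hi₀ hi₁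
    rcases hy : q (.inr i) with y | j
    · exact ⟨y, rfl⟩
    · exfalso
      fin_cases j
      · exact hi₀ (hinj hy hs₀)
      · exact hi₁ (hinj hy hs₁)
  -- The predecessors of the two marks decide the configuration: both are points and the marks lie
  -- on different arcs; or mark `0` immediately precedes mark `1`; or mark `1` immediately precedes
  -- mark `0`. In the last two cases `a = b`, and the order selects the disjunct. If both
  -- predecessors were marks, there would be a cycle of marks.
  rcases s₀ with a | i
  · rcases s₁ with b | j
    · have hab : a ≠ b := by
        rintro rfl
        simpa using hs₀.symm.trans hs₁
      obtain ⟨y₀, hy₀⟩ := hpoint 0 (by simp) (by simp)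
      obtain ⟨y₁, hy₁⟩ := hpoint 1 (by simp) (by simp)
      have ha := hinr _ _ _ hs₀ hy₀
      have hb := hinr _ _ _ hs₁ hy₁
      refine ⟨a, b, fun z hz => ?_, fun z hz => ?_, fun z hz => ?_, fun z hz => ?_, .inl ?_⟩
      · simpa using hinj hz hs₀
      · exact hinr _ _ _ hs₀ hz
      · simpa using hinj hz hs₁
      · exact hinr _ _ _ hs₁ hz
      · intro z
        by_cases hza : z = a
        · subst hza
          simp [hab, hs₀, hy₀, ha]
        · by_cases hzb : z = b
          · subst hzb
            simp [hza, hs₁, hy₁, hb]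
          · simp [hza, hzb, hother z (by simpa using hza) (by simpa using hzb)]
    · have hj : j = 0 := by
        have := hfix 1
        fin_cases j
        · rfl
        · exact absurd hs₁ this
      subst hj
      obtain ⟨y, hy⟩ := hpoint 1 (by simp) (by simp)
      have ha := hinrr _ _ _ _ hs₀ hs₁ hy
      refine ⟨a, a, fun z hz => ?_, fun z hz => ?_, fun z hz => ?_, fun z hz => ?_, .inl ?_⟩
      · simpa using hinj hz hs₀
      · simp [hs₁] at hz
      · simpa using hinj hz hs₁
      · exact hinrr _ _ _ _ hs₀ hs₁ hz
      · intro z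
        by_cases hza : z = a
        · subst hza
          simp [hs₀, hs₁, hy, ha]
        · simp [hza, hother z (by simpa using hza) (by simp)]
  · have hi : i = 1 := by
      have := hfix 0
      fin_cases i
      · exact absurd hs₀ this
      · rfl
    subst hi
    rcases s₁ with b | j
    · obtain ⟨y, hy⟩ := hpoint 0 (by simp) (by simp)
      have hb := hinrr _ _ _ _ hs₁ hs₀ hy
      refine ⟨b, b, fun z hz => ?_, fun z hz => ?_, fun z hz => ?_, fun z hz => ?_, .inr ?_⟩
      · simpa using hinj hz hs₀
      · exact hinrr _ _ _ _ hs₁ hs₀ hz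
      · simpa using hinj hz hs₁
      · simp [hs₀] at hz
      · intro z
        by_cases hzb : z = b
        · subst hzb
          simp [hs₀, hs₁, hy, hb]
        · simp [hzb, hother z (by simp) (by simpa using hzb)]
    · exfalso
      fin_cases j
      · exact hswap ⟨hs₁, hs₀⟩
      · exact hfix 1 hs₁

/-! ### Circuits of a picture -/

/-- The two halves of an edge at a passage: `(p, true)` leaves `p` and `(p, false)` arrives at
`p`. -/
abbrev HalfEdge (c : ℕ) : Type := (Fin c × Level) × Bool

namespace Picture

variable {n c : ℕ} (D : Picture n c)

/-- This and the next three definitions are finite counterparts of those for a graph, with the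
Boolean recording whether the half edge leaves the crossing. They make corners of a concrete picture
decidable. -/
def underLeft (v : Fin c) : HalfEdge c := ((v, .lower), decide (D.sign v = 1))

def underRight (v : Fin c) : HalfEdge c := ((v, .lower), !decide (D.sign v = 1))

def overLeft (v : Fin c) : HalfEdge c := ((v, .upper), !decide (D.sign v = 1))

def overRight (v : Fin c) : HalfEdge c := ((v, .upper), decide (D.sign v = 1))

/-- The pairs of lines that are joined at the crossing `v`. -/
def corners (v : Fin c) : List ((HalfEdge c × Fin 3) × (HalfEdge c × Fin 3)) :=
  [((D.underLeft v, 0), (D.underRight v, 0)), ((D.underLeft v, 2), (D.overRight v, 0)),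
    ((D.underRight v, 2), (D.overRight v, 2)), ((D.underLeft v, 1), (D.overLeft v, 0)),
    ((D.underRight v, 1), (D.overLeft v, 2)), ((D.overRight v, 1), (D.overLeft v, 1))]

/-- The lines `x` and `y` are joined at a crossing of the picture, or they are the same line of an
inner edge, with `x` named by the beginning and `y` by the end of the edge. -/
def Joins (x y : HalfEdge c × Fin 3) : Prop :=
  (∃ v, (x, y) ∈ D.corners v) ∨
    ((x.1.2 = true ∧ y.1.2 = false ∧ x.2 = y.2) ∧ ∃ k, [x.1.1, y.1.1] <:+: D.strand k)

instance : DecidableRel D.Joins := fun x y => by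
  unfold Joins; infer_instance

end Picture

namespace NormalOGraph

variable {Γ : NormalOGraph}

/-- The edge of `Γ` that contains the half edge. -/
def edgeOf {W : Type} {c : ℕ} (f : W ⊕ Fin c ≃ Γ.V) (h : HalfEdge c) : Γ.Edge :=
  if h.2 then (f (.inr h.1.1), h.1.2) else Γ.next.symm (f (.inr h.1.1), h.1.2)

/-- Equal signs make the corners of the picture corners of `Γ`, and the two ends of an inner edge
name the same edge of `Γ`. -/
theorem sameCircuit_of_joins {n c : ℕ} {D : Picture n c} {W : Type} {f : W ⊕ Fin c ≃ Γ.V}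
    (hs : ∀ i, Γ.sign (f (.inr i)) = D.sign i)
    (hc : ∀ k, Γ.Consecutive ((D.strand k).map fun p => (f (.inr p.1), p.2)))
    {x y : HalfEdge c × Fin 3} (h : D.Joins x y) :
    Γ.SameCircuit (edgeOf f x.1, x.2) (edgeOf f y.1, y.2) := by
  rcases h with ⟨v, hv⟩ | ⟨⟨hx, hy, hxy⟩, k, hk⟩
  · have huL : edgeOf f (D.underLeft v) = Γ.underLeft (f (.inr v)) := by
      simp [edgeOf, Picture.underLeft, underLeft, hs, inEdge, outEdge]
    have huR : edgeOf f (D.underRight v) = Γ.underRight (f (.inr v)) := by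
      by_cases h : D.sign v = 1 <;>
        simp [edgeOf, Picture.underRight, underRight, hs, inEdge, outEdge, h]
    have hoL : edgeOf f (D.overLeft v) = Γ.overLeft (f (.inr v)) := by
      by_cases h : D.sign v = 1 <;>
        simp [edgeOf, Picture.overLeft, overLeft, hs, inEdge, outEdge, h]
    have hoR : edgeOf f (D.overRight v) = Γ.overRight (f (.inr v)) := by
      simp [edgeOf, Picture.overRight, overRight, hs, inEdge, outEdge]
    simp only [Picture.corners, List.mem_cons, Prod.mk.injEq, List.not_mem_nil, or_false] at hv
    apply Relation.EqvGen.rel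
    rcases hv with ⟨rfl, rfl⟩ | ⟨rfl, rfl⟩ | ⟨rfl, rfl⟩ | ⟨rfl, rfl⟩ | ⟨rfl, rfl⟩ | ⟨rfl, rfl⟩ <;>
      simp only [huL, huR, hoL, hoR]
    · exact .c01 _
    · exact .c02 _
    · exact .c03 _
    · exact .c12 _
    · exact .c13 _
    · exact .c23 _
  · have := (hc k).next_eq (hk.map _)
    have he : edgeOf f x.1 = edgeOf f y.1 := by
      simp only [edgeOf, hx, hy, if_true, Bool.false_eq_true, if_false]
      exact (Equiv.symm_apply_eq _).2 this.symm |>.symm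
    rw [he, hxy]
    exact .refl _

/-- The exterior does not enter: a path of lines within the picture is a piece of a circuit in every
realization. This is what makes the conditions of the slides local. -/
theorem sameCircuit_of_isChain {n c : ℕ} {D : Picture n c} {W : Type} {f : W ⊕ Fin c ≃ Γ.V}
    (hs : ∀ i, Γ.sign (f (.inr i)) = D.sign i)
    (hc : ∀ k, Γ.Consecutive ((D.strand k).map fun p => (f (.inr p.1), p.2)))
    {x y : HalfEdge c × Fin 3} {l : List (HalfEdge c × Fin 3)}
    (h : (x :: (l ++ [y])).IsChain fun x y => D.Joins x y ∨ D.Joins y x) :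
    Γ.SameCircuit (edgeOf f x.1, x.2) (edgeOf f y.1, y.2) := by
  have step : ∀ {x y}, (D.Joins x y ∨ D.Joins y x) →
      Γ.SameCircuit (edgeOf f x.1, x.2) (edgeOf f y.1, y.2) := by
    rintro x y (h | h)
    · exact sameCircuit_of_joins hs hc h
    · exact (sameCircuit_of_joins hs hc h).symm
  induction l generalizing x with
  | nil => exact step (by simpa using h)
  | cons z l ih =>
    obtain ⟨h, h'⟩ := List.isChain_cons_cons.1 h
    exact (step h).trans _ _ _ (ih h')

end NormalOGraph

/-! ### Pure sliding moves between pictures -/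

/-- The half edge `h` is adjacent to the gap `i` of the template. -/
def Template.Borders {n m s : ℕ} (T : Template n m s) (i : Fin s) (h : HalfEdge m) : Prop :=
  ∃ k, (if h.2 then [.inl h.1, .inr i] else [.inr i, .inl h.1]) <:+: T.strand k

instance {n m s : ℕ} (T : Template n m s) (i : Fin s) (h : HalfEdge m) :
    Decidable (T.Borders i h) := by
  unfold Template.Borders; infer_instance

/-- The picture `D` is the template `T` with its gaps closed. -/
structure Template.IsErasure {n m s : ℕ} (T : Template n m s) (D : Picture n m) : Prop where
  sign : ∀ i, D.sign i = T.sign i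
  strand : ∀ k, D.strand k = (T.strand k).filterMap Sum.getLeft?
  ne_nil : ∀ k, D.strand k ≠ []

/-- Filling the gaps of a template with two strands in Reidemeister II position is a pure sliding
move, if the required lines are connected inside the template with its gaps closed. -/
theorem PSType.rel_of_isFill {t : PSType} {n m d : ℕ} {T : Template n m 2} {D : Picture n m}
    {D' : Picture n d} {e : Fin m ⊕ Fin 2 → Fin d} (hT : IsPartition T.strand)
    (hD : T.IsErasure D) (hD' : T.IsFill t.picture D' e) (a b : HalfEdge m)
    (ha : T.Borders 0 a) (hb : T.Borders 1 b) (l : List (HalfEdge m × Fin 3))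
    (hl : ((a, t.lines.1) :: (l ++ [(b, t.lines.2)])).IsChain fun x y => D.Joins x y ∨ D.Joins y x)
    {W : Type} {σ : W → ℤˣ} {ctx : Equiv.Perm ((W × Level) ⊕ Fin n)} {Γ Γ' : NormalOGraph}
    (h : Γ.Realizes D σ ctx) (h' : Γ'.Realizes D' σ ctx) : t.Rel Γ Γ' := by
  classical
  -- The gaps become two marks on the edges of `Γ`: erasing them from the splice recovers `Γ`, while
  -- filling them with the Reidemeister II strands gives `Γ'`.
  obtain ⟨q₀, hq₀⟩ := hT.exists_splice ctx
  obtain ⟨f, hf₁, hf₂, hf₃⟩ := realizes_iff.1 h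
  obtain ⟨g, hg₁, hg₂, hg₃⟩ := realizes_iff.1 (h'.of_isFill hT hD' hq₀)
  let Z := (W ⊕ Fin m) × Level
  let q : Equiv.Perm (Z ⊕ Fin 2) := spliceContext q₀
  let E : (W × Level) ⊕ ((Fin m × Level) ⊕ Fin 2) ≃ Z ⊕ Fin 2 :=
    (Equiv.sumAssoc _ _ _).symm.trans
      (Equiv.sumCongr (Equiv.sumProdDistrib W (Fin m) Level).symm (Equiv.refl (Fin 2)))
  have hqE : ∀ t, q (E t) = E (q₀ t) := by
    intro t
    change E (q₀ (E.symm (E t))) = _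
    rw [Equiv.symm_apply_apply]
  let F : Z ≃ Γ.Edge := Equiv.prodCongr f (Equiv.refl Level)
  let word : (W × Level) ⊕ Fin n → List (Z ⊕ Fin 2) := fun x => (block T.strand x).map E
  have hword : ∀ x, (word x ++ word (ctx x)).IsChain (fun s t => q s = t) := by
    intro x
    rw [← List.map_append]
    refine (List.isChain_map _).2 ((hq₀ x).imp ?_)
    rintro s t rfl
    exact hqE s
  have herase : ∀ x, ((word x).filterMap Sum.getLeft?).map F = passages D f x := by
    rintro (x | k)
    · rfl
    · simp only [word, block, passages, Sum.elim_inr, hD.strand, List.map_map, List.filterMap_map,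
        List.map_filterMap]
      congr 1
      funext u
      rcases u with p | i <;> rfl
  have herase_ne : ∀ x, (word x).filterMap Sum.getLeft? ≠ [] := by
    intro x hx
    have := herase x
    rw [hx] at this
    exact passages_ne_nil hD.ne_nil f x this.symm
  -- No strand becomes empty when its gaps are closed, so the following block always contains a
  -- surviving point. Hence no orbit consists of marks.
  have hsplit : ∀ u, ∃ x l₁ l₂, word x ++ word (ctx x) = l₁ ++ u :: l₂ ∧
      l₂.filterMap Sum.getLeft? ≠ [] := by
    intro u
    obtain ⟨x, hx⟩ := hT.mem_block (X := W × Level) (E.symm u)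
    have hu : u ∈ word x := List.mem_map.2 ⟨_, hx, by simp⟩
    obtain ⟨l₁, l₂, hl₁⟩ := List.append_of_mem hu
    refine ⟨x, l₁, l₂ ++ word (ctx x), by simp [hl₁], ?_⟩
    rw [List.filterMap_append]
    simp [herase_ne]
  let nx : Z → Z := fun z => F.symm (Γ.next (F z))
  have h₁ : ∀ z, FirstPoint q (q (.inl z)) (nx z) := by
    intro z
    obtain ⟨x, l₁, l₂, hl₁, hl₂⟩ := hsplit (.inl z)
    obtain ⟨y, r, hy⟩ := List.exists_cons_of_ne_nil hl₂
    have hnx : nx z = y := by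
      refine (Equiv.symm_apply_eq _).2 ((hf₃ x).next_eq ?_)
      rw [← herase, ← herase, ← List.map_append, ← List.filterMap_append, hl₁,
        List.filterMap_append, List.filterMap_cons_some (f := Sum.getLeft?) (b := z) rfl, hy,
        List.map_append]
      exact ⟨_, r.map F, by rw [List.append_assoc]; rfl⟩
    have hc : (Sum.inl z :: l₂).IsChain (fun s t => q s = t) :=
      (hl₁ ▸ hword x).right_of_append
    rw [hnx]
    obtain ⟨u, l₃, rfl⟩ : ∃ u l₃, l₂ = u :: l₃ := by
      apply List.exists_cons_of_ne_nil
      rintro rfl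
      simp at hy
    obtain ⟨rfl, hc'⟩ := List.isChain_cons_cons.1 hc
    exact .of_isChain hc' hy
  have h₂ : ∀ i, ∃ z, FirstPoint q (.inr i) z := by
    intro i
    obtain ⟨x, l₁, l₂, hl₁, hl₂⟩ := hsplit (.inr i)
    obtain ⟨y, r, hy⟩ := List.exists_cons_of_ne_nil hl₂
    exact ⟨y, .of_isChain (hl₁ ▸ hword x).right_of_append
      ((List.filterMap_cons_none rfl).trans hy)⟩
  obtain ⟨za, zb, ha₁, ha₂, hb₁, hb₂, harcs⟩ := exists_arcs q nx h₁ h₂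
  -- A half edge next to a gap, on either side, belongs to the edge of `Γ` that carries the mark.
  -- The path of lines given by `l` therefore joins the edges where the slide takes place.
  have hborder : ∀ (i : Fin 2) (c : HalfEdge m) (z : Z), T.Borders i c →
      (∀ y, q (.inl y) = .inr i → y = z) → (∀ y, q (.inr i) = .inl y → nx z = y) →
      edgeOf f c = F z := by
    rintro i ⟨⟨v, s⟩, o⟩ z ⟨k, hk⟩ hz₁ hz₂
    have hc : (word (.inr k)).IsChain (fun s t => q s = t) := (hword (.inr k)).left_of_append
    have hk' := (hk.map Sum.inr).map E
    have := hc.infix hk'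
    cases o
    · have := hz₂ (.inr v, s) (List.isChain_pair (R := fun s t => q s = t).1 this)
      have hF : F (.inr v, s) = (f (.inr v), s) := rfl
      simp only [edgeOf, Bool.false_eq_true, if_false]
      rw [Equiv.symm_apply_eq, ← hF, ← this]
      simp [nx]
    · have := hz₁ (.inr v, s) (List.isChain_pair (R := fun s t => q s = t).1 this)
      rw [← this]
      rfl
  -- Replacing marks by the strands of the slide turns the arcs found above into the words required
  -- in `Γ'`.
  have hlift : ∀ r : List (Z ⊕ Fin 2), r.IsChain (fun s t => q s = t) →
      Γ'.Consecutive (r.flatMap (passages t.picture g)) := by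
    intro r hr
    refine isChain_flatMap (passages_ne_nil (fun k => ?_) g) hg₃ hr
    cases t <;> fin_cases k <;> simp [PSType.picture]
  refine ⟨F za, F zb, ?_, (Equiv.sumCongr f.symm (Equiv.refl _)).trans g, fun v => ?_, hg₂, ?_⟩
  · rw [← hborder 0 a za ha ha₁ ha₂, ← hborder 1 b zb hb hb₁ hb₂]
    exact sameCircuit_of_isChain hf₂ (fun k => (hf₃ (.inr k)).left_of_append) hl
  · obtain ⟨w | i, rfl⟩ := f.surjective v
    · simp [hf₁, hg₁]
    · simp [hf₂, hg₁, hD.sign]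
  · have hnext : ∀ z, Γ.next (F z) = F (nx z) := by simp [nx]
    have hF₁ : ∀ z, f.symm (F z).1 = z.1 := fun z => f.symm_apply_apply z.1
    have hF₂ : ∀ z, (F z).2 = z.2 := fun _ => rfl
    refine harcs.imp (fun H => ?_) (fun H => ?_) <;>
    · intro u
      obtain ⟨z, rfl⟩ := F.surjective u
      have := hlift _ (H z)
      rw [hnext]
      simp only [EmbeddingLike.apply_eq_iff_eq]
      split_ifs at this ⊢ <;> simpa [passages, hF₁, hF₂] using this

/-! ### Connectedness -/

namespace NormalOGraph

/-- The crossings `v` and `w` lie in the same component. -/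
def Linked (Γ : NormalOGraph) : Γ.V → Γ.V → Prop :=
  Relation.EqvGen fun a b => ∃ s t : Level, Γ.next (a, s) = (b, t)

variable {Γ Γ' : NormalOGraph}

theorem linked_next (p : Γ.V × Level) : Γ.Linked p.1 (Γ.next p).1 :=
  .rel _ _ ⟨p.2, (Γ.next p).2, rfl⟩

theorem Consecutive.linked_head {p q : Γ.V × Level} {l : List (Γ.V × Level)}
    (h : Γ.Consecutive (p :: l)) (hq : q ∈ p :: l) : Γ.Linked p.1 q.1 := by
  induction l generalizing p with
  | nil =>
    obtain rfl : q = p := by simpa using hq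
    exact .refl _
  | cons r l ih =>
    obtain ⟨rfl, h'⟩ := List.isChain_cons_cons.1 h
    rcases List.mem_cons.1 hq with rfl | hq
    · exact .refl _
    · exact (linked_next p).trans _ _ _ (ih h' hq)

theorem Consecutive.linked {p q : Γ.V × Level} {l : List (Γ.V × Level)} (h : Γ.Consecutive l)
    (hp : p ∈ l) (hq : q ∈ l) : Γ.Linked p.1 q.1 := by
  cases l with
  | nil => simp at hp
  | cons r l => exact (h.linked_head hp).symm.trans _ _ _ (h.linked_head hq)

theorem Consecutive.next_mem {p : Γ.V × Level} {l r : List (Γ.V × Level)}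
    (h : Γ.Consecutive (l ++ r)) (hr : r ≠ []) (hp : p ∈ l) : Γ.next p ∈ l ++ r :=
  (exists_infix_of_mem h hr hp).subset (by simp)

/-- A map of crossings that respects components and meets all of them. -/
theorem IsConnected.of_map (φ : Γ.V → Γ'.V) (h : ∀ p, Γ'.Linked (φ p.1) (φ (Γ.next p).1))
    (hφ : ∀ v', ∃ v, Γ'.Linked (φ v) v') (hΓ : Γ.IsConnected) : Γ'.IsConnected := by
  obtain ⟨⟨v₀⟩, hv⟩ := hΓ
  have hmap : ∀ v w, Γ.Linked v w → Γ'.Linked (φ v) (φ w) := by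
    intro v w hvw
    induction hvw with
    | rel v w hvw =>
      obtain ⟨s, t, hst⟩ := hvw
      simpa [hst] using h (v, s)
    | refl v => exact .refl _
    | symm v w _ ih => exact ih.symm
    | trans u v w _ _ ih₁ ih₂ => exact ih₁.trans _ _ _ ih₂
  refine ⟨⟨φ v₀⟩, fun v' w' => ?_⟩
  obtain ⟨v, hv'⟩ := hφ v'
  obtain ⟨w, hw'⟩ := hφ w'
  exact (hv'.symm.trans _ _ _ (hmap v w (hv v w))).trans _ _ _ hw'

theorem linked_of_joined {x y : Γ.Line} (h : Γ.Joined x y) : Γ.Linked x.1.1 y.1.1 := by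
  have hin : ∀ v s, Γ.Linked (Γ.inEdge v s).1 v := fun v s => by
    simpa [inEdge] using linked_next (Γ.next.symm (v, s))
  have hout : ∀ v s, Γ.Linked (Γ.outEdge v s).1 v := fun v s => .refl _
  have huL : ∀ v, Γ.Linked (Γ.underLeft v).1 v := fun v => by
    unfold underLeft; split_ifs <;> simp [hin, hout]
  have huR : ∀ v, Γ.Linked (Γ.underRight v).1 v := fun v => by
    unfold underRight; split_ifs <;> simp [hin, hout]
  have hoL : ∀ v, Γ.Linked (Γ.overLeft v).1 v := fun v => by
    unfold overLeft; split_ifs <;> simp [hin, hout]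
  have hoR : ∀ v, Γ.Linked (Γ.overRight v).1 v := fun v => by
    unfold overRight; split_ifs <;> simp [hin, hout]
  cases h with
  | c01 v => exact (huL v).trans _ _ _ (huR v).symm
  | c02 v => exact (huL v).trans _ _ _ (hoR v).symm
  | c03 v => exact (huR v).trans _ _ _ (hoR v).symm
  | c12 v => exact (huL v).trans _ _ _ (hoL v).symm
  | c13 v => exact (huR v).trans _ _ _ (hoL v).symm
  | c23 v => exact (hoR v).trans _ _ _ (hoL v).symm

/-- Lines are joined only at crossings, so a circuit never leaves its component. Thus the two arcs
of a slide are connected before the move. -/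
theorem linked_of_sameCircuit {x y : Γ.Line} (h : Γ.SameCircuit x y) : Γ.Linked x.1.1 y.1.1 := by
  induction h with
  | rel x y h => exact linked_of_joined h
  | refl x => exact .refl _
  | symm x y _ ih => exact ih.symm
  | trans x y z _ _ ih₁ ih₂ => exact ih₁.trans _ _ _ ih₂

/-- Replacing a picture by one in which the crossing `i₀` shares a strand with every crossing
preserves connectedness. -/
theorem IsConnected.of_realizes {n c c' : ℕ} {D : Picture n c} {D' : Picture n c'} {W : Type}
    {σ : W → ℤˣ} {ctx : Equiv.Perm ((W × Level) ⊕ Fin n)} (hD : IsPartition D.strand)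
    (hD' : ∀ k, D'.strand k ≠ []) (j : Fin c) (i₀ : Fin c')
    (hub : ∀ i, ∃ k s t, (i₀, s) ∈ D'.strand k ∧ (i, t) ∈ D'.strand k)
    (h : Γ.Realizes D σ ctx) (h' : Γ'.Realizes D' σ ctx) (hΓ : Γ.IsConnected) :
    Γ'.IsConnected := by
  obtain ⟨f, -, -, hf⟩ := realizes_iff.1 h
  obtain ⟨g, -, -, hg⟩ := realizes_iff.1 h'
  -- The exterior is kept and the whole old picture collapses to the hub `i₀`. Passages consecutive
  -- in `Γ` then have equal images or come from blocks `x` and `ctx x`, which are linked in `Γ'`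
  -- because every strand of `D'` is linked to the hub.
  let anchor : W ⊕ Fin c → Γ'.V := Sum.elim (fun w => g (.inl w)) (fun _ => g (.inr i₀))
  let pos : (W × Level) ⊕ Fin n → Γ'.V :=
    Sum.elim (fun p => g (.inl p.1)) (fun _ => g (.inr i₀))
  have hcross : ∀ i, Γ'.Linked (g (.inr i₀)) (g (.inr i)) := by
    intro i
    obtain ⟨k, s, t, hs, ht⟩ := hub i
    exact Consecutive.linked (hg (.inr k)).left_of_append
      (p := (g (.inr i₀), s)) (q := (g (.inr i), t))
      (List.mem_map.2 ⟨_, hs, rfl⟩) (List.mem_map.2 ⟨_, ht, rfl⟩)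
  have h₁ : ∀ x, ∀ y ∈ passages D f x, anchor (f.symm y.1) = pos x := by
    rintro (x | k) y hy
    · obtain rfl : y = _ := by simpa [passages] using hy
      simp [anchor, pos]
    · obtain ⟨p, -, rfl⟩ := List.mem_map.1 hy
      simp [anchor, pos]
  have h₂ : ∀ x, ∀ y ∈ passages D' g x, Γ'.Linked (pos x) y.1 := by
    rintro (x | k) y hy
    · obtain rfl : y = _ := by simpa [passages] using hy
      exact .refl _
    · obtain ⟨p, -, rfl⟩ := List.mem_map.1 hy
      exact hcross p.1
  have h₃ : ∀ x, Γ'.Linked (pos x) (pos (ctx x)) := by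
    intro x
    obtain ⟨y, hy⟩ := List.exists_mem_of_ne_nil _ (passages_ne_nil hD' g x)
    obtain ⟨z, hz⟩ := List.exists_mem_of_ne_nil _ (passages_ne_nil hD' g (ctx x))
    exact ((h₂ x y hy).trans _ _ _ ((hg x).linked (List.mem_append_left _ hy)
      (List.mem_append_right _ hz))).trans _ _ _ (h₂ _ z hz).symm
  refine hΓ.of_map (fun v => anchor (f.symm v)) (fun p => ?_) (fun v' => ?_)
  · obtain ⟨x, hx⟩ := exists_mem_passages hD.mem f p
    simp only [h₁ x p hx]
    rcases List.mem_append.1 ((hf x).next_mem (passages_ne_nil hD.ne_nil f _) hx) with hp | hp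
    · rw [h₁ _ _ hp]
      exact .refl _
    · rw [h₁ _ _ hp]
      exact h₃ x
  · obtain ⟨w | i, rfl⟩ := g.surjective v'
    · exact ⟨f (.inl w), by simpa [anchor] using .refl _⟩
    · exact ⟨f (.inr j), by simpa [anchor] using hcross i⟩

end NormalOGraph

/-- Crossing `0` is a hub in both pictures of the move. -/
theorem primaryMP_isConnected_iff {Γ Γ' : NormalOGraph} (h : primaryMP.Rel Γ Γ') :
    Γ.IsConnected ↔ Γ'.IsConnected := by
  obtain ⟨W, σ, ctx, hb, ha⟩ := h
  exact ⟨.of_realizes (by decide) (by decide) 0 0 (by decide) hb ha,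
    .of_realizes (by decide) (by decide) 0 0 (by decide) ha hb⟩

/-- The words of a pure sliding move, disregarding the order of the two arcs on a common edge. -/
theorem PSType.Rel.exists_words {t : PSType} {Γ Γ' : NormalOGraph} (h : t.Rel Γ Γ') :
    ∃ (a b : Γ.Edge) (f : Γ.V ⊕ Fin 2 ≃ Γ'.V) (M : Γ.Edge → List (Γ'.V × Level)),
      Γ.Linked a.1 b.1 ∧
      (∀ e, Γ'.Consecutive ((f (.inl e.1), e.2) :: M e ++
        [(f (.inl (Γ.next e).1), (Γ.next e).2)])) ∧
      ∀ e y, y ∈ M e ↔ ∃ p, y = (f (.inr p.1), p.2) ∧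
        (e = a ∧ p ∈ t.picture.strand 0 ∨ e = b ∧ p ∈ t.picture.strand 1) := by
  classical
  obtain ⟨a, b, hab, f, -, -, h⟩ := h
  have hmem : ∀ (k : Fin 2) (e c : Γ.Edge) (y : Γ'.V × Level),
      y ∈ (if e = c then (t.picture.strand k).map fun p => (f (.inr p.1), p.2) else []) ↔
        ∃ p, y = (f (.inr p.1), p.2) ∧ (e = c ∧ p ∈ t.picture.strand k) := by
    intro k e c y
    split_ifs with hec
    · simp only [hec, true_and, List.mem_map]
      exact ⟨fun ⟨p, hp, hy⟩ => ⟨p, hy.symm, hp⟩, fun ⟨p, hy, hp⟩ => ⟨p, hp, hy.symm⟩⟩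
    · simp [hec]
  let new : Fin 2 → Γ.Edge → Γ.Edge → List (Γ'.V × Level) := fun k c e =>
    if e = c then (t.picture.strand k).map fun p => (f (.inr p.1), p.2) else []
  rcases h with h | h
  · refine ⟨a, b, f, fun e => new 0 a e ++ new 1 b e, linked_of_sameCircuit hab, fun e => by
      simpa only [List.append_assoc, List.cons_append, List.nil_append] using h e, ?_⟩
    intro e y
    rw [List.mem_append, hmem, hmem, ← exists_or]
    simp only [and_or_left]
  · refine ⟨a, b, f, fun e => new 1 b e ++ new 0 a e, linked_of_sameCircuit hab, fun e => by
      simpa only [List.append_assoc, List.cons_append, List.nil_append] using h e, ?_⟩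
    intro e y
    rw [List.mem_append, hmem, hmem, ← exists_or]
    simp only [and_or_left, or_comm]

theorem PSType.exists_mem_strand_zero (t : PSType) (i : Fin 2) :
    ∃ s, (i, s) ∈ t.picture.strand 0 := by
  cases t <;> fin_cases i <;> decide

theorem PSType.mem_strand (t : PSType) (p : Fin 2 × Level) :
    p ∈ t.picture.strand 0 ∨ p ∈ t.picture.strand 1 := by
  obtain ⟨i, s⟩ := p
  cases t <;> fin_cases i <;> cases s <;> decide

/-- In the forward direction, subdividing edges keeps old crossings linked, and both new crossings
lie on the left arc. Backwards, deleting the new crossings could separate the two arcs, were they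
not linked in `Γ` by a circuit. -/
theorem PSType.isConnected_iff {t : PSType} {Γ Γ' : NormalOGraph} (h : t.Rel Γ Γ') :
    Γ.IsConnected ↔ Γ'.IsConnected := by
  obtain ⟨a, b, f, M, hab, hM, hmem⟩ := h.exists_words
  constructor
  · refine fun hΓ => hΓ.of_map (fun v => f (.inl v)) (fun p => ?_) (fun v' => ?_)
    · exact (hM p).linked (p := (f (.inl p.1), p.2))
        (q := (f (.inl (Γ.next p).1), (Γ.next p).2)) (by simp) (by simp)
    · obtain ⟨v | i, rfl⟩ := f.surjective v'
      · exact ⟨v, .refl _⟩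
      · obtain ⟨s, hs⟩ := t.exists_mem_strand_zero i
        refine ⟨a.1, (hM a).linked (p := (f (.inl a.1), a.2)) (q := (f (.inr i), s)) (by simp) ?_⟩
        have : (f (.inr i), s) ∈ M a := (hmem _ _).2 ⟨(i, s), rfl, .inl ⟨rfl, hs⟩⟩
        simp [this]
  -- Both new crossings are sent to the start of the left edge. On the edge `b` this respects
  -- components only because of `hab`.
  · let ψ : Γ'.V → Γ.V := fun v' => Sum.elim id (fun _ => a.1) (f.symm v')
    have hψ₁ : ∀ v, ψ (f (.inl v)) = v := by simp [ψ]
    have hψ₂ : ∀ i, ψ (f (.inr i)) = a.1 := by simp [ψ]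
    have hlinked : ∀ e, ∀ y ∈ (f (.inl e.1), e.2) :: M e ++
        [(f (.inl (Γ.next e).1), (Γ.next e).2)], Γ.Linked e.1 (ψ y.1) := by
      intro e y hy
      rw [List.mem_append, List.mem_cons, List.mem_singleton] at hy
      rcases hy with (rfl | hy) | rfl
      · rw [hψ₁]; exact .refl _
      · obtain ⟨p, rfl, ⟨rfl, -⟩ | ⟨rfl, -⟩⟩ := (hmem e y).1 hy
        · rw [hψ₂]; exact .refl _
        · rw [hψ₂]; exact hab.symm
      · rw [hψ₁]; exact linked_next e
    refine fun hΓ => hΓ.of_map ψ (fun p => ?_) (fun v => ⟨f (.inl v), by rw [hψ₁]; exact .refl _⟩)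
    obtain ⟨e, he⟩ : ∃ e, p ∈ (f (.inl e.1), e.2) :: M e := by
      obtain ⟨v', s⟩ := p
      obtain ⟨v | i, rfl⟩ := f.surjective v'
      · exact ⟨(v, s), by simp⟩
      · rcases t.mem_strand (i, s) with h | h
        · exact ⟨a, List.mem_cons_of_mem _ ((hmem _ _).2 ⟨(i, s), rfl, .inl ⟨rfl, h⟩⟩)⟩
        · exact ⟨b, List.mem_cons_of_mem _ ((hmem _ _).2 ⟨(i, s), rfl, .inr ⟨rfl, h⟩⟩)⟩
    exact (hlinked e p (List.mem_append_left _ he)).symm.trans _ _ _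
      (hlinked e _ ((hM e).next_mem (by simp) he))

theorem Step.isConnected_iff {s : Step} {Γ Γ' : NormalOGraph} (h : s.Rel Γ Γ') :
    Γ.IsConnected ↔ Γ'.IsConnected := by
  rcases s with (_ | t) | (_ | t)
  · exact primaryMP_isConnected_iff h
  · exact PSType.isConnected_iff h
  · exact (primaryMP_isConnected_iff h).symm
  · exact (PSType.isConnected_iff h).symm

/-! ### Sequences of moves -/

/-- `Γ'` is obtained from `Γ` by the successive letters of the word `w`. -/
def MovePath : List Step → NormalOGraph → NormalOGraph → Prop
  | [], Γ, Γ' => Γ = Γ'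
  | s :: w, Γ, Γ' => ∃ Γ₁, s.Rel Γ Γ₁ ∧ MovePath w Γ₁ Γ'

theorem MovePath.append {w w' : List Step} {Γ Γ₁ Γ' : NormalOGraph} (h : MovePath w Γ Γ₁)
    (h' : MovePath w' Γ₁ Γ') : MovePath (w ++ w') Γ Γ' := by
  induction w generalizing Γ with
  | nil => obtain rfl : Γ = Γ₁ := h; exact h'
  | cons s w ih =>
    obtain ⟨Γ₂, hs, hw⟩ := h
    exact ⟨Γ₂, hs, ih hw⟩

def Step.symm : Step → Step
  | forward g => inverse g
  | inverse g => forward g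

theorem Step.Rel.symm {s : Step} {Γ Γ' : NormalOGraph} (h : s.Rel Γ Γ') : s.symm.Rel Γ' Γ := by
  cases s <;> exact h

/-- The inverse word. -/
def inverseWord (w : List Step) : List Step := (w.map Step.symm).reverse

theorem MovePath.symm {w : List Step} {Γ Γ' : NormalOGraph} (h : MovePath w Γ Γ') :
    MovePath (inverseWord w) Γ' Γ := by
  induction w generalizing Γ with
  | nil => exact Eq.symm h
  | cons s w ih =>
    obtain ⟨Γ₁, hs, hw⟩ := h
    simp only [inverseWord, List.map_cons, List.reverse_cons]
    exact (ih hw).append ⟨Γ, hs.symm, rfl⟩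

theorem MovePath.exists_sequence {w : List Step} {Γ Γ' : NormalOGraph} (h : MovePath w Γ Γ') :
    ∃ Δ : Fin (w.length + 1) → NormalOGraph,
      Δ 0 = Γ ∧ Δ (Fin.last w.length) = Γ' ∧
      (∀ i : Fin w.length, (w.get i).Rel (Δ i.castSucc) (Δ i.succ)) ∧
      (Γ.IsConnected → ∀ i, (Δ i).IsConnected) := by
  induction w generalizing Γ with
  | nil => exact ⟨fun _ => Γ, rfl, h, fun i => i.elim0, fun hΓ _ => hΓ⟩
  | cons s w ih =>
    obtain ⟨Γ₁, hs, hw⟩ := h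
    obtain ⟨Δ, h₀, h₁, h₂, h₃⟩ := ih hw
    refine ⟨Fin.cons Γ Δ, rfl, h₁, fun i => ?_, fun hΓ i => ?_⟩
    · refine Fin.cases ?_ (fun j => ?_) i
      · change s.Rel Γ (Δ 0)
        rwa [h₀]
      · exact h₂ j
    · refine Fin.cases hΓ (fun j => ?_) i
      exact h₃ ((Step.isConnected_iff hs).1 hΓ) j

/-- In every context, the word `w` leads from the picture `D` to the picture `D'`. -/
def Picture.Derives (w : List Step) {n c c' : ℕ} (D : Picture n c) (D' : Picture n c') : Prop :=
  ∀ (W : Type) (σ : W → ℤˣ) (ctx : Equiv.Perm ((W × Level) ⊕ Fin n)) (Γ Γ' : NormalOGraph),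
    Γ.Realizes D σ ctx → Γ'.Realizes D' σ ctx → MovePath w Γ Γ'

/-- The local move `M` is a sequence of generating moves. -/
def LocalMove.Generated (M : LocalMove) : Prop :=
  ∃ w, M.before.Derives w M.after

namespace Picture.Derives

variable {n c c' c'' m : ℕ} {D : Picture n c} {D' : Picture n c'} {D'' : Picture n c''}

/-- The intermediate graph has to be constructed in the given context; this is why `D'` must be a
partition, while finiteness of the exterior comes from `Γ`. -/
theorem trans {w w' : List Step} (hD' : IsPartition D'.strand) (h : D.Derives w D')
    (h' : D'.Derives w' D'') : D.Derives (w ++ w') D'' := by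
  intro W σ ctx Γ Γ'' hΓ hΓ''
  have := hΓ.finite
  obtain ⟨Γ', hΓ'⟩ := Picture.exists_realizes hD' σ ctx
  exact (h W σ ctx Γ Γ' hΓ hΓ').append (h' W σ ctx Γ' Γ'' hΓ' hΓ'')

theorem symm {w : List Step} (h : D.Derives w D') : D'.Derives (inverseWord w) D :=
  fun W σ ctx Γ Γ' hΓ hΓ' => (h W σ ctx Γ' Γ hΓ' hΓ).symm

/-- The template joins the exterior. Since `hM` covers all contexts, the enlarged one needs no new
word. -/
theorem of_move {M : LocalMove} {w : List Step} (hM : M.before.Derives w M.after)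
    (T : Template n m 3) (e : Fin m ⊕ Fin 2 → Fin c) (e' : Fin m ⊕ Fin 3 → Fin c')
    (hT : IsPartition T.strand) (hD : T.IsFill M.before D e) (hD' : T.IsFill M.after D' e') :
    D.Derives w D' := by
  intro W σ ctx Γ Γ' hΓ hΓ'
  obtain ⟨W', σ', ctx', h, h'⟩ := LocalMove.rel_of_isFill hT hD hD' hΓ hΓ'
  exact hM W' σ' ctx' Γ Γ' h h'

theorem primary : primaryMP.before.Derives [.forward .primary] primaryMP.after :=
  fun W σ ctx _ Γ' hΓ hΓ' => ⟨Γ', ⟨W, σ, ctx, hΓ, hΓ'⟩, rfl⟩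

end Picture.Derives

/-! ### Derivations of the MP moves -/

/-- The picture `B` filled into the gaps of the template `T`, with the crossings of `T` first. -/
def Template.fill {n m s c : ℕ} (T : Template n m s) (B : Picture s c) : Picture n (m + c) where
  sign := Fin.append T.sign B.sign
  strand k := (T.strand k).flatMap (letter B finSumFinEquiv)

theorem Template.isFill_fill {n m s c : ℕ} (T : Template n m s) (B : Picture s c) :
    T.IsFill B (T.fill B) finSumFinEquiv :=
  ⟨finSumFinEquiv.bijective, by simp [fill], by simp [fill], fun _ => rfl⟩

instance {n m s c d : ℕ} (T : Template n m s) (B : Picture s c) (D : Picture n d)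
    (e : Fin m ⊕ Fin c → Fin d) : Decidable (T.IsFill B D e) :=
  decidable_of_iff (Function.Bijective e ∧ (∀ i, D.sign (e (.inl i)) = T.sign i) ∧
      (∀ i, D.sign (e (.inr i)) = B.sign i) ∧
      ∀ k, D.strand k = (T.strand k).flatMap (Template.letter B e))
    ⟨fun h => ⟨h.1, h.2.1, h.2.2.1, h.2.2.2⟩, fun h => ⟨h.1, h.2, h.3, h.4⟩⟩

/-- The gaps of the template `T`, which erases to `D`, can be filled by a pure sliding move of type
`t`: they lie at the half edges `a` and `b`, and the required lines are connected through `l`. -/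
structure PSType.IsSlide (t : PSType) {n m : ℕ} (T : Template n m 2) (D : Picture n m)
    (a b : HalfEdge m) (l : List (HalfEdge m × Fin 3)) : Prop where
  isPartition : IsPartition T.strand
  sign : ∀ i, D.sign i = T.sign i
  strand : ∀ k, D.strand k = (T.strand k).filterMap Sum.getLeft?
  ne_nil : ∀ k, D.strand k ≠ []
  borders_left : T.Borders 0 a
  borders_right : T.Borders 1 b
  isChain : ((a, t.lines.1) :: (l ++ [(b, t.lines.2)])).IsChain fun x y => D.Joins x y ∨ D.Joins y x
  fill : IsPartition (T.fill t.picture).strand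

instance (t : PSType) {n m : ℕ} (T : Template n m 2) (D : Picture n m) (a b : HalfEdge m)
    (l : List (HalfEdge m × Fin 3)) : Decidable (t.IsSlide T D a b l) :=
  decidable_of_iff (IsPartition T.strand ∧ (∀ i, D.sign i = T.sign i) ∧
      (∀ k, D.strand k = (T.strand k).filterMap Sum.getLeft?) ∧ (∀ k, D.strand k ≠ []) ∧
      T.Borders 0 a ∧ T.Borders 1 b ∧
      ((a, t.lines.1) :: (l ++ [(b, t.lines.2)])).IsChain (fun x y => D.Joins x y ∨ D.Joins y x) ∧
      IsPartition (T.fill t.picture).strand)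
    ⟨fun ⟨h₁, h₂, h₃, h₄, h₅, h₆, h₇, h₈⟩ => ⟨h₁, h₂, h₃, h₄, h₅, h₆, h₇, h₈⟩,
      fun ⟨h₁, h₂, h₃, h₄, h₅, h₆, h₇, h₈⟩ => ⟨h₁, h₂, h₃, h₄, h₅, h₆, h₇, h₈⟩⟩

theorem PSType.IsSlide.derives {t : PSType} {n m : ℕ} {T : Template n m 2} {D : Picture n m}
    {a b : HalfEdge m} {l : List (HalfEdge m × Fin 3)} (h : t.IsSlide T D a b l) :
    D.Derives [.forward (.slide t)] (T.fill t.picture) := fun _ _ _ _ Γ' hΓ hΓ' =>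
  ⟨Γ', PSType.rel_of_isFill h.isPartition ⟨h.sign, h.strand, h.ne_nil⟩ (T.isFill_fill t.picture)
    a b h.borders_left h.borders_right l h.isChain hΓ hΓ', rfl⟩

namespace LocalMove.Generated

theorem rel_path {M : LocalMove} (hM : M.Generated) :
    ∃ w, ∀ Γ Γ', M.Rel Γ Γ' → MovePath w Γ Γ' := by
  obtain ⟨w, hw⟩ := hM
  exact ⟨w, fun Γ Γ' ⟨W, σ, ctx, h, h'⟩ => hw W σ ctx Γ Γ' h h'⟩

theorem primaryMP : primaryMP.Generated :=
  ⟨_, Picture.Derives.primary⟩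

/-- A move that consists of a pure sliding move followed by the inverse of another move. -/
theorem of_slide_of_inverse {M N : LocalMove} (hN : N.Generated) (t : PSType) (T : Template 3 2 2)
    (a b : HalfEdge 2) (l : List (HalfEdge 2 × Fin 3)) (S : Template 3 1 3)
    (e : Fin 1 ⊕ Fin 3 → Fin 4) (e' : Fin 1 ⊕ Fin 2 → Fin 3) (hT : t.IsSlide T M.before a b l)
    (hS : IsPartition S.strand) (he : S.IsFill N.after (T.fill t.picture) e)
    (he' : S.IsFill N.before M.after e') : M.Generated := by
  obtain ⟨w, hw⟩ := hN
  exact ⟨_, hT.derives.trans hT.fill (hw.of_move S e' e hS he' he).symm⟩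

/-- A move that consists of a pure sliding move, another move and an inverse pure sliding move. -/
theorem of_slide_of_move_of_slide {M N : LocalMove} (hN : N.Generated) (t : PSType)
    (T : Template 3 2 2) (a b : HalfEdge 2) (l : List (HalfEdge 2 × Fin 3)) (t' : PSType)
    (T' : Template 3 3 2) (a' b' : HalfEdge 3) (l' : List (HalfEdge 3 × Fin 3))
    (S : Template 3 2 3) (e : Fin 2 ⊕ Fin 2 → Fin 4) (e' : Fin 2 ⊕ Fin 3 → Fin 5)
    (hT : t.IsSlide T M.before a b l) (hT' : t'.IsSlide T' M.after a' b' l')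
    (hS : IsPartition S.strand) (he : S.IsFill N.before (T.fill t.picture) e)
    (he' : S.IsFill N.after (T'.fill t'.picture) e') : M.Generated := by
  obtain ⟨w, hw⟩ := hN
  exact ⟨_, (hT.derives.trans hT.fill (hw.of_move S e e' hS he he')).trans hT'.fill
    hT'.derives.symm⟩

end LocalMove.Generated

/-! ### The sixteen derivations -/

open Level

/-- A template without crossings of its own only relists the strands, here in opposite order. -/
theorem generated_D2 : (MPType.move .D2).Generated :=
  ⟨_, Picture.Derives.primary.of_move
    (⟨![], ![[.inr 2], [.inr 1], [.inr 0]]⟩ : Template 3 0 3) (Sum.elim ![] ![0, 1])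
    (Sum.elim ![] ![0, 1, 2]) (by decide) (by decide) (by decide)⟩

/-- In this pattern the two old crossings and one of the new crossings `2`, `3` form the larger
picture of the known move; the other new crossing survives as the crossing of `S`. Here and below,
the path for a slide turns a corner at one crossing, follows one inner edge, and turns a corner at
the next. For the first slide that edge is the one on strand `1` between the two old crossings. -/
theorem generated_A1 : (MPType.move .A1).Generated :=
  .of_slide_of_inverse .primaryMP
    .I
    ⟨![1, 1], ![[.inl (0, lower), .inr 1], [.inl (1, upper), .inl (0, upper)], [.inl (1, lower),
    .inr 0]]⟩
    ((1, lower), true) ((0, lower), true)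
    [(((1, upper), true), 0), (((0, upper), false), 0)]
    ⟨![-1], ![[.inr 2, .inl (0, lower)], [.inr 0], [.inr 1, .inl (0, upper)]]⟩
    (Sum.elim ![3] ![1, 0, 2])
    (Sum.elim ![2] ![1, 0])
    (by decide) (by decide) (by decide) (by decide)

/-- In this pattern the known move acts on one old and one new crossing. The other old crossing is
cancelled by the final inverse slide, together with a crossing of the known move's larger picture;
the other new crossing remains in the result. -/
theorem generated_A2 : (MPType.move .A2).Generated :=
  .of_slide_of_move_of_slide .primaryMP
    .IV
    ⟨![-1, 1], ![[.inl (0, lower), .inr 1], [.inl (1, upper), .inl (0, upper)], [.inr 0,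
    .inl (1, lower)]]⟩
    ((1, lower), false) ((0, lower), true)
    [(((1, upper), true), 2), (((0, upper), false), 2)]
    .III
    ⟨![1, -1, 1], ![[.inr 1, .inl (2, lower), .inl (1, lower)], [.inl (0, upper), .inr 0],
    [.inl (1, upper), .inl (0, lower), .inl (2, upper)]]⟩
    ((0, upper), true) ((2, lower), false)
    [(((0, lower), true), 2), (((2, upper), false), 2)]
    ⟨![-1, -1], ![[.inl (0, lower), .inr 2, .inl (1, lower)], [.inr 0, .inl (0, upper)],
    [.inl (1, upper), .inr 1]]⟩
    (Sum.elim ![0, 2] ![3, 1])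
    (Sum.elim ![4, 1] ![0, 3, 2])
    (by decide) (by decide) (by decide) (by decide) (by decide)

theorem generated_B3 : (MPType.move .B3).Generated :=
  .of_slide_of_inverse .primaryMP
    .II
    ⟨![1, 1], ![[.inr 1, .inl (0, upper)], [.inl (0, lower), .inl (1, lower)], [.inr 0,
    .inl (1, upper)]]⟩
    ((1, upper), false) ((0, upper), false)
    [(((1, lower), false), 1), (((0, lower), true), 1)]
    ⟨![-1], ![[.inl (0, upper), .inr 0], [.inr 2], [.inl (0, lower), .inr 1]]⟩
    (Sum.elim ![2] ![3, 0, 1])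
    (Sum.elim ![1] ![0, 2])
    (by decide) (by decide) (by decide) (by decide)

theorem generated_B4 : (MPType.move .B4).Generated :=
  .of_slide_of_move_of_slide .primaryMP
    .IV
    ⟨![-1, 1], ![[.inr 0, .inl (0, upper)], [.inl (0, lower), .inl (1, lower)], [.inl (1, upper),
    .inr 1]]⟩
    ((0, upper), false) ((1, upper), true)
    [(((0, lower), true), 2), (((1, lower), false), 2)]
    .III
    ⟨![1, 1, -1], ![[.inl (2, upper), .inl (1, upper), .inr 0], [.inr 1, .inl (0, lower)],
    [.inl (1, lower), .inl (0, upper), .inl (2, lower)]]⟩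
    ((1, upper), true) ((0, lower), false)
    [(((1, lower), true), 2), (((0, upper), false), 2)]
    ⟨![-1, -1], ![[.inl (1, upper), .inr 0, .inl (0, upper)], [.inl (0, lower), .inr 2], [.inr 1,
    .inl (1, lower)]]⟩
    (Sum.elim ![0, 2] ![1, 3])
    (Sum.elim ![4, 2] ![1, 3, 0])
    (by decide) (by decide) (by decide) (by decide) (by decide)

theorem generated_B1 : (MPType.move .B1).Generated :=
  .of_slide_of_move_of_slide generated_A2
    .II
    ⟨![-1, -1], ![[.inr 1, .inl (0, upper)], [.inl (1, lower), .inl (0, lower)], [.inr 0,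
    .inl (1, upper)]]⟩
    ((1, upper), false) ((0, upper), false)
    [(((1, lower), true), 2), (((0, lower), false), 2)]
    .III
    ⟨![-1, -1, 1], ![[.inl (1, upper), .inl (2, upper)], [.inr 1, .inl (0, lower)],
    [.inl (1, lower), .inl (0, upper), .inl (2, lower), .inr 0]]⟩
    ((2, lower), true) ((0, lower), false)
    [(((2, lower), false), 0), (((0, upper), true), 0)]
    ⟨![-1, -1], ![[.inl (1, upper), .inr 1], [.inl (0, lower), .inr 0], [.inl (1, lower), .inr 2,
    .inl (0, upper)]]⟩
    (Sum.elim ![1, 2] ![0, 3])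
    (Sum.elim ![4, 1] ![2, 0, 3])
    (by decide) (by decide) (by decide) (by decide) (by decide)

theorem generated_B2 : (MPType.move .B2).Generated :=
  .of_slide_of_move_of_slide generated_A1
    .IV
    ⟨![1, -1], ![[.inr 0, .inl (0, upper)], [.inl (1, lower), .inl (0, lower)], [.inl (1, upper),
    .inr 1]]⟩
    ((0, upper), false) ((1, upper), true)
    [(((0, lower), false), 1), (((1, lower), true), 1)]
    .II
    ⟨![-1, 1, -1], ![[.inl (2, upper), .inl (1, upper)], [.inr 0, .inl (0, lower)], [.inr 1,
    .inl (1, lower), .inl (0, upper), .inl (2, lower)]]⟩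
    ((0, lower), false) ((1, lower), false)
    [(((0, upper), false), 0), (((1, lower), true), 0)]
    ⟨![-1, -1], ![[.inl (1, upper), .inr 1], [.inl (0, lower), .inr 0], [.inl (0, upper), .inr 2,
    .inl (1, lower)]]⟩
    (Sum.elim ![1, 2] ![0, 3])
    (Sum.elim ![3, 2] ![1, 4, 0])
    (by decide) (by decide) (by decide) (by decide) (by decide)

theorem generated_C1 : (MPType.move .C1).Generated :=
  .of_slide_of_inverse generated_B3
    .I
    ⟨![1, -1], ![[.inl (0, lower)], [.inl (1, lower), .inl (0, upper), .inr 1], [.inl (1, upper),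
    .inr 0]]⟩
    ((1, upper), true) ((0, upper), true)
    [(((1, lower), true), 1), (((0, upper), false), 1)]
    ⟨![-1], ![[.inr 1], [.inr 2, .inl (0, lower)], [.inr 0, .inl (0, upper)]]⟩
    (Sum.elim ![3] ![0, 1, 2])
    (Sum.elim ![0] ![1, 2])
    (by decide) (by decide) (by decide) (by decide)

theorem generated_C2 : (MPType.move .C2).Generated :=
  .of_slide_of_inverse generated_B1
    .I
    ⟨![-1, -1], ![[.inl (0, lower)], [.inl (1, lower), .inl (0, upper), .inr 1], [.inl (1, upper),
    .inr 0]]⟩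
    ((1, upper), true) ((0, upper), true)
    [(((1, lower), true), 1), (((0, upper), false), 1)]
    ⟨![-1], ![[.inr 1], [.inr 2, .inl (0, lower)], [.inr 0, .inl (0, upper)]]⟩
    (Sum.elim ![3] ![0, 1, 2])
    (Sum.elim ![0] ![1, 2])
    (by decide) (by decide) (by decide) (by decide)

theorem generated_C3 : (MPType.move .C3).Generated :=
  .of_slide_of_inverse .primaryMP
    .III
    ⟨![1, 1], ![[.inr 1, .inl (0, lower)], [.inl (1, lower), .inl (0, upper)], [.inl (1, upper),
    .inr 0]]⟩
    ((1, upper), true) ((0, lower), false)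
    [(((1, lower), true), 2), (((0, upper), false), 2)]
    ⟨![-1], ![[.inl (0, lower), .inr 2], [.inr 1], [.inr 0, .inl (0, upper)]]⟩
    (Sum.elim ![3] ![1, 2, 0])
    (Sum.elim ![1] ![2, 0])
    (by decide) (by decide) (by decide) (by decide)

theorem generated_C4 : (MPType.move .C4).Generated :=
  .of_slide_of_inverse generated_A1
    .II
    ⟨![-1, 1], ![[.inr 0, .inl (0, lower)], [.inr 1, .inl (1, lower), .inl (0, upper)],
    [.inl (1, upper)]]⟩
    ((0, lower), false) ((1, lower), false)
    [(((0, upper), false), 0), (((1, lower), true), 0)]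
    ⟨![-1], ![[.inl (0, lower), .inr 0], [.inl (0, upper), .inr 2], [.inr 1]]⟩
    (Sum.elim ![2] ![1, 3, 0])
    (Sum.elim ![2] ![1, 0])
    (by decide) (by decide) (by decide) (by decide)

theorem generated_D1 : (MPType.move .D1).Generated :=
  .of_slide_of_inverse generated_A2
    .III
    ⟨![-1, 1], ![[.inr 1, .inl (0, lower)], [.inl (0, upper), .inl (1, lower), .inr 0],
    [.inl (1, upper)]]⟩
    ((1, lower), true) ((0, lower), false)
    [(((1, lower), false), 0), (((0, upper), true), 0)]
    ⟨![-1], ![[.inl (0, lower), .inr 0], [.inr 2, .inl (0, upper)], [.inr 1]]⟩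
    (Sum.elim ![3] ![1, 0, 2])
    (Sum.elim ![2] ![1, 0])
    (by decide) (by decide) (by decide) (by decide)

theorem generated_D3 : (MPType.move .D3).Generated :=
  .of_slide_of_inverse generated_B2
    .III
    ⟨![-1, -1], ![[.inl (0, lower)], [.inr 1, .inl (0, upper), .inl (1, lower)], [.inl (1, upper),
    .inr 0]]⟩
    ((1, upper), true) ((0, upper), false)
    [(((1, lower), false), 1), (((0, upper), true), 1)]
    ⟨![-1], ![[.inr 1], [.inl (0, lower), .inr 2], [.inr 0, .inl (0, upper)]]⟩
    (Sum.elim ![3] ![0, 2, 1])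
    (Sum.elim ![0] ![1, 2])
    (by decide) (by decide) (by decide) (by decide)

theorem generated_D4 : (MPType.move .D4).Generated :=
  .of_slide_of_inverse generated_B4
    .III
    ⟨![1, -1], ![[.inl (0, lower)], [.inr 1, .inl (0, upper), .inl (1, lower)], [.inl (1, upper),
    .inr 0]]⟩
    ((1, upper), true) ((0, upper), false)
    [(((1, lower), false), 1), (((0, upper), true), 1)]
    ⟨![-1], ![[.inr 1], [.inl (0, lower), .inr 2], [.inr 0, .inl (0, upper)]]⟩
    (Sum.elim ![3] ![0, 2, 1])
    (Sum.elim ![0] ![1, 2])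
    (by decide) (by decide) (by decide) (by decide)

theorem generated_A3 : (MPType.move .A3).Generated :=
  .of_slide_of_inverse generated_C2
    .I
    ⟨![-1, -1], ![[.inr 1, .inl (0, lower)], [.inl (0, upper), .inl (1, upper)], [.inr 0,
    .inl (1, lower)]]⟩
    ((1, lower), false) ((0, lower), false)
    [(((1, upper), false), 0), (((0, upper), true), 0)]
    ⟨![1], ![[.inl (0, lower), .inr 0], [.inr 2], [.inl (0, upper), .inr 1]]⟩
    (Sum.elim ![2] ![1, 0, 3])
    (Sum.elim ![1] ![2, 0])
    (by decide) (by decide) (by decide) (by decide)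

theorem generated_A4 : (MPType.move .A4).Generated :=
  .of_slide_of_inverse generated_C1
    .IV
    ⟨![1, -1], ![[.inl (0, lower), .inr 1], [.inl (0, upper), .inl (1, upper)], [.inr 0,
    .inl (1, lower)]]⟩
    ((1, lower), false) ((0, lower), true)
    [(((1, upper), false), 0), (((0, upper), true), 0)]
    ⟨![-1], ![[.inr 0, .inl (0, lower)], [.inr 2], [.inl (0, upper), .inr 1]]⟩
    (Sum.elim ![2] ![1, 0, 3])
    (Sum.elim ![1] ![2, 0])
    (by decide) (by decide) (by decide) (by decide)

theorem MPType.generated : ∀ m : MPType, m.move.Generated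
  | .A1 => generated_A1
  | .A2 => generated_A2
  | .A3 => generated_A3
  | .A4 => generated_A4
  | .B1 => generated_B1
  | .B2 => generated_B2
  | .B3 => generated_B3
  | .B4 => generated_B4
  | .C1 => generated_C1
  | .C2 => generated_C2
  | .C3 => generated_C3
  | .C4 => generated_C4
  | .D1 => generated_D1
  | .D2 => generated_D2
  | .D3 => generated_D3
  | .D4 => generated_D4

theorem mainTheorem1 (m : MPType) :
    ∃ w : List Step, ∀ Γ Γ' : NormalOGraph, m.move.Rel Γ Γ' →
      ∃ Δ : Fin (w.length + 1) → NormalOGraph,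
        Δ 0 = Γ ∧ Δ (Fin.last w.length) = Γ' ∧
        (∀ i : Fin w.length, (w.get i).Rel (Δ i.castSucc) (Δ i.succ)) ∧
        (Γ.IsConnected → ∀ i, (Δ i).IsConnected) := by
  obtain ⟨w, hw⟩ := m.generated.rel_path
  exact ⟨w, fun Γ Γ' h => (hw Γ Γ' h).exists_sequence⟩
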